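/- Let $\widehat{\mathfrak{sl}}_2=\mathfrak{sl}_2[T,T^{-1}]\oplus\mathbb{C}c$ be the affine Lie algebra with $c$ central and $$[aT^i,bT^j]=[a,b]T^{i+j}+i\,\mathrm{tr}(ab)\,\delta_{i+j,0}\,c ,$$ let $e,f,h$ be the standard generators of $\mathfrak{sl}_2$ ($[e,f]=h$, $[h,e]=2e$, $[h,f]=-2f$), and put $e_1=e$, $f_1=f$, $h_1=h$, $e_2=fT$, $f_2=eT^{-1}$, $h_2=c-h$. For $a\in\mathfrak{sl}_2$ write $\frac{a}{T^n}=aT^{-n}$. For $M,k\in\mathbb{C}$ let $V=V(M,k-M)$ be the Verma module generated by a vector $v$ subject to $e_1v=e_2v=0$, $h_1v=Mv$, $h_2v=(k-M)v$, graded by $\gamma=(p_1,p_2)\in\mathbb{Z}_{\ge 0}^2$, where $f_{i_1}\cdots f_{i_p}v$ has degree $(p_1,p_2)$ with $p_i$ the number of $i$'s among $i_1,\dots,i_p$. Let $V^*=\bigoplus_\gamma V_\gamma^*$ be the contragredient dual, with $\langle f_i\phi,x\rangle=\langle\phi,e_ix\rangle$ and $\langle e_i\phi,x\rangle=\langle\phi,f_ix\rangle$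 for $i=1,2$. Each $V_\gamma$ has a basis of ordered monomials of degree $\gamma$, namely $$\tfrac{f}{T^{i_1}}\cdots\tfrac{f}{T^{i_a}}\tfrac{h}{T^{j_1}}\cdots\tfrac{h}{T^{j_b}}\tfrac{e}{T^{l_1}}\cdots\tfrac{e}{T^{l_c}}v\quad\text{if } p_1\ge p_2,\qquad \tfrac{e}{T^{l_1}}\cdots\tfrac{e}{T^{l_c}}\tfrac{h}{T^{j_1}}\cdots\tfrac{h}{T^{j_b}}\tfrac{f}{T^{i_1}}\cdots\tfrac{f}{T^{i_a}}v\quad\text{if } p_1<p_2,$$ with $i_1\ge\dots\ge i_a\ge 0$, $j_1\ge\dots\ge j_b\ge 1$, $l_1\ge\dots\ge l_c\ge 1$. Consequently for each such monomial $m$ of degree $\gamma$ there is exactly one vector $(m)^*\in V^*$ that vanishes on $V_{\gamma'}$ for $\gamma'\ne\gamma$, takes the value $1$ on $m$ and the value $0$ on the other basis monomials of $V_\gamma$ (the dual basis vector). With this notation the following identities hold in $V(M,k-M)^*$ for all $M,k\in\mathbb{C}$. (a) For $b\ge 1$, $$(M+b(k+2))\Big(\frac{f}{T^b}v\Big)^*=\frac{f}{T^b}\cdot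 v^*-\sum_{l=1}^b\Big[2\frac{e}{T^l}\sum_{i+j=b-l,\ i\ge j\ge 0}\Big(\frac{f}{T^i}\frac{f}{T^j}v\Big)^*+\frac{h}{T^l}\Big(\frac{f}{T^{b-l}}v\Big)^*\Big].$$ (b) For $b\ge 2$, $$(k-M+(b-1)(k+2))\Big(\frac{e}{T^b}v\Big)^*=\frac{e}{T^b}\cdot v^*+\sum_{l=0}^{b-2}\Big[-2\frac{f}{T^l}\sum_{i+j=b-l,\ i\ge j\ge 1}\Big(\frac{e}{T^i}\frac{e}{T^j}v\Big)^*+\frac{h}{T^{l+1}}\Big(\frac{e}{T^{b-l-1}}v\Big)^*\Big].$$ -/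

import Mathlib

noncomputable section

namespace AffineSl2

open scoped TensorProduct
open LieModule.Cohomology

/-! ### The Lie algebra `sl₂` -/

/-- The Lie algebra of complex `2 × 2` matrices with trace zero. -/
abbrev sl2 : Type := LieAlgebra.SpecialLinear.sl (Fin 2) ℂ

theorem mem_sl2 {A : Matrix (Fin 2) (Fin 2) ℂ} (hA : A.trace = 0) :
    A ∈ LieAlgebra.SpecialLinear.sl (Fin 2) ℂ := by
  simpa [LieAlgebra.SpecialLinear.sl] using hA

/-- The standard generator `e` of `sl₂`. -/
def sl2E : sl2 := ⟨!![0, 1; 0, 0], mem_sl2 (by simp [Matrix.trace_fin_two])⟩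

/-- The standard generator `f` of `sl₂`. -/
def sl2F : sl2 := ⟨!![0, 0; 1, 0], mem_sl2 (by simp [Matrix.trace_fin_two])⟩

/-- The standard generator `h` of `sl₂`. -/
def sl2H : sl2 := ⟨!![1, 0; 0, -1], mem_sl2 (by simp [Matrix.trace_fin_two])⟩

theorem lie_E_F : ⁅sl2E, sl2F⁆ = sl2H := by
  ext i j
  fin_cases i <;> fin_cases j <;> simp [sl2E, sl2F, sl2H, Ring.lie_def]

theorem lie_H_E : ⁅sl2H, sl2E⁆ = (2 : ℂ) • sl2E := by
  ext i j
  fin_cases i <;> fin_cases j <;> simp [sl2E, sl2H, Ring.lie_def]; norm_num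

theorem lie_H_F : ⁅sl2H, sl2F⁆ = (-2 : ℂ) • sl2F := by
  ext i j
  fin_cases i <;> fin_cases j <;> simp [sl2F, sl2H, Ring.lie_def]; norm_num

theorem sl2_eq (a : sl2) :
    a = (a.1 0 1) • sl2E + (a.1 1 0) • sl2F + (a.1 0 0) • sl2H := by
  have ha : Matrix.trace a.1 = 0 := by
    have := a.2
    simpa [LieAlgebra.SpecialLinear.sl] using this
  rw [Matrix.trace_fin_two] at ha
  ext i j
  fin_cases i <;> fin_cases j <;> simp [sl2E, sl2F, sl2H]
  linear_combination ha

/-- The invariant form `⟨a, b⟩ = tr (a b)` on `sl₂`. -/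
def trForm : LinearMap.BilinForm ℂ sl2 :=
  LinearMap.mk₂ ℂ (fun a b => Matrix.trace (a.1 * b.1))
    (by intros; simp [add_mul]) (by intros; simp)
    (by intros; simp [mul_add]) (by intros; simp)

theorem trForm_apply (a b : sl2) : trForm a b = Matrix.trace (a.1 * b.1) := rfl

theorem neg_trForm_isSymm : (-trForm).IsSymm := ⟨fun a b => by
  simp [trForm_apply, Matrix.trace_mul_comm a.1 b.1]⟩

theorem neg_trForm_lieInvariant : (-trForm).lieInvariant sl2 := by
  intro a b c
  simp only [LinearMap.neg_apply, neg_neg, trForm_apply, LieAlgebra.SpecialLinear.sl_bracket,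
    sub_mul, mul_sub, Matrix.trace_sub]
  rw [Matrix.trace_mul_cycle a.1 b.1 c.1, Matrix.trace_mul_comm (c.1 * a.1), mul_assoc b.1 a.1 c.1,
    ← mul_assoc b.1 c.1 a.1]
  rw [mul_assoc b.1 c.1 a.1]
  ring

/-! ### The affine Lie algebra -/

/-- The loop algebra `sl₂[T, T⁻¹]`. -/
abbrev LoopSl2 : Type := LieAlgebra.loopAlgebra ℂ ℤ sl2

/-- The cocycle `(a Tⁱ, b Tʲ) ↦ i tr (a b) δ_{i + j, 0}`. The sign in front of the trace form is
there because Mathlib's residue pairing of `a Tⁱ` and `b Tʲ` has the factor `j` instead of `i`. -/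
def cocycle : twoCocycle ℂ LoopSl2 (TrivialLieModule ℂ LoopSl2 ℂ) :=
  LieAlgebra.LoopAlgebra.twoCocycleOfBilinear ℂ ℤ sl2 (-trForm) neg_trForm_lieInvariant
    neg_trForm_isSymm

/-- The affine Lie algebra `sl₂[T, T⁻¹] ⊕ ℂ c`. -/
abbrev Affine : Type := LieAlgebra.ofTwoCocycle cocycle

/-- The element `a Tⁿ` of the affine Lie algebra. -/
def loop (n : ℤ) : sl2 →ₗ[ℂ] Affine where
  toFun a := LieAlgebra.ofProd cocycle (AddMonoidAlgebra.single n 1 ⊗ₜ[ℂ] a, 0)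
  map_add' a b := by rw [← LieAlgebra.of_add]; simp [TensorProduct.tmul_add]
  map_smul' r a := by rw [RingHom.id_apply, ← LieAlgebra.of_smul]; simp

/-- The central element. -/
def central : Affine :=
  LieAlgebra.ofProd cocycle (0, (TrivialLieModule.equiv ℂ LoopSl2 ℂ).symm 1)

theorem cocycle_tmul (i j : ℤ) (a b : sl2) :
    (cocycle : LoopSl2 →ₗ[ℂ] LoopSl2 →ₗ[ℂ] TrivialLieModule ℂ LoopSl2 ℂ)
      (AddMonoidAlgebra.single i 1 ⊗ₜ[ℂ] a) (AddMonoidAlgebra.single j 1 ⊗ₜ[ℂ] b) =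
    (TrivialLieModule.equiv ℂ LoopSl2 ℂ).symm (if i + j = 0 then (i : ℂ) * trForm a b else 0) := by
  have h0 : (cocycle : LoopSl2 →ₗ[ℂ] LoopSl2 →ₗ[ℂ] TrivialLieModule ℂ LoopSl2 ℂ)
      (AddMonoidAlgebra.single i 1 ⊗ₜ[ℂ] a) (AddMonoidAlgebra.single j 1 ⊗ₜ[ℂ] b) =
      (TrivialLieModule.equiv ℂ LoopSl2 ℂ).symm
        (LieAlgebra.LoopAlgebra.residuePairing ℂ ℤ sl2 (-trForm)
          (AddMonoidAlgebra.single i 1 ⊗ₜ[ℂ] a) (AddMonoidAlgebra.single j 1 ⊗ₜ[ℂ] b)) := rfl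
  rw [h0]
  congr 1
  rw [LieAlgebra.LoopAlgebra.residuePairing_apply_apply]
  simp only [LieAlgebra.LoopAlgebra.toFinsupp_single_tmul]
  rw [Finsupp.sum_single_index (by simp)]
  by_cases hij : i + j = 0
  · obtain rfl : j = -i := by omega
    simp
  · rw [if_neg hij, Finsupp.single_eq_of_ne (by omega)]
    simp

theorem lie_loop (i j : ℤ) (a b : sl2) :
    ⁅loop i a, loop j b⁆ =
      loop (i + j) ⁅a, b⁆ + (if i + j = 0 then (i : ℂ) * trForm a b else 0) • central := by
  rw [LieAlgebra.bracket_ofTwoCocycle]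
  simp only [loop, central, LinearMap.coe_mk, AddHom.coe_mk, Equiv.symm_apply_apply,
    ← LieAlgebra.of_smul, ← LieAlgebra.of_add]
  congr 1
  rw [cocycle_tmul]
  ext1
  · rw [LieAlgebra.ExtendScalars.bracket_tmul, AddMonoidAlgebra.single_mul_single, mul_one]
    simp only [Prod.fst_add, Prod.smul_fst, smul_zero, add_zero]
  · simp only [lie_zero, add_zero, sub_zero, Prod.snd_add, Prod.smul_snd, zero_add]
    rw [← map_smul, smul_eq_mul, mul_one]

theorem lie_central (x : Affine) : ⁅x, central⁆ = 0 := by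
  rw [LieAlgebra.bracket_ofTwoCocycle]
  simp only [central, Equiv.symm_apply_apply, lie_zero, map_zero, trivial_lie_zero,
    add_zero, sub_zero]
  rfl

@[elab_as_elim]
theorem affine_induction {P : Affine → Prop} (hl : ∀ n a, P (loop n a)) (hc : P central)
    (hadd : ∀ x y, P x → P y → P (x + y)) (hsmul : ∀ (r : ℂ) x, P x → P (r • x)) (x : Affine) :
    P x := by
  have key : ∀ u : LoopSl2, P (LieAlgebra.ofProd cocycle (u, 0)) := by
    intro u
    induction u using TensorProduct.induction_on with
    | zero =>
      have := hsmul 0 _ hc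
      rw [zero_smul] at this
      exact this
    | tmul p a =>
      induction p using AddMonoidAlgebra.induction_linear with
      | zero =>
        have := hsmul 0 _ hc
        rw [zero_smul] at this
        rw [TensorProduct.zero_tmul]
        exact this
      | add p q hp hq =>
        have := hadd _ _ hp hq
        rw [← LieAlgebra.of_add] at this
        rw [TensorProduct.add_tmul]
        simpa using this
      | single n r =>
        have := hsmul r _ (hl n a)
        simp only [loop, LinearMap.coe_mk, AddHom.coe_mk, ← LieAlgebra.of_smul] at this
        have hr : (AddMonoidAlgebra.single n r : AddMonoidAlgebra ℂ ℤ) =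
            r • AddMonoidAlgebra.single n 1 := by
          rw [AddMonoidAlgebra.smul_single, smul_eq_mul, mul_one]
        rw [Prod.smul_mk, smul_zero, TensorProduct.smul_tmul', ← hr] at this
        exact this
    | add u w hu hw =>
      have := hadd _ _ hu hw
      rw [← LieAlgebra.of_add] at this
      simpa using this
  have h1 := hadd _ _ (key ((LieAlgebra.ofProd cocycle).symm x).1)
    (hsmul (TrivialLieModule.equiv ℂ LoopSl2 ℂ ((LieAlgebra.ofProd cocycle).symm x).2) _ hc)
  have h2 : LieAlgebra.ofProd cocycle (((LieAlgebra.ofProd cocycle).symm x).1, 0) +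
      TrivialLieModule.equiv ℂ LoopSl2 ℂ ((LieAlgebra.ofProd cocycle).symm x).2 • central = x := by
    rw [central, ← LieAlgebra.of_smul, ← LieAlgebra.of_add, ← Equiv.eq_symm_apply]
    ext1
    · simp
    · simp only [Prod.snd_add, Prod.smul_snd, zero_add]
      rw [← map_smul, smul_eq_mul, mul_one]
      simp
  rwa [h2] at h1

/-- The Chevalley generators `e₁ = e`, `e₂ = f T`. -/
def chevE : Fin 2 → Affine := ![loop 0 sl2E, loop 1 sl2F]

/-- The Chevalley generators `f₁ = f`, `f₂ = e T⁻¹`. -/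
def chevF : Fin 2 → Affine := ![loop 0 sl2F, loop (-1) sl2E]

/-- The Chevalley generators `h₁ = h`, `h₂ = c - h`. -/
def chevH : Fin 2 → Affine := ![loop 0 sl2H, central - loop 0 sl2H]

/-- Transposition on `sl₂`: it exchanges `e` and `f` and fixes `h`. -/
def sl2Transpose : sl2 →ₗ[ℂ] sl2 where
  toFun a := ⟨a.1.transpose, mem_sl2 (by
    have := a.2
    simpa [LieAlgebra.SpecialLinear.sl] using this)⟩
  map_add' a b := by ext; simp
  map_smul' r a := by ext; simp

/-- The linear anti-involution `a Tⁿ ↦ aᵗ T⁻ⁿ`, `c ↦ c`. It exchanges `eᵢ` and `fᵢ`. -/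
def tau : Affine →ₗ[ℂ] Affine where
  toFun x := LieAlgebra.ofProd cocycle
    (TensorProduct.map (LaurentPolynomial.invert (R := ℂ)).toLinearMap sl2Transpose
      ((LieAlgebra.ofProd cocycle).symm x).1, ((LieAlgebra.ofProd cocycle).symm x).2)
  map_add' x y := by rw [← LieAlgebra.of_add]; simp
  map_smul' r x := by rw [RingHom.id_apply, ← LieAlgebra.of_smul]; simp

theorem tau_loop (n : ℤ) (a : sl2) : tau (loop n a) = loop (-n) (sl2Transpose a) := by
  simp [tau, loop]

theorem tau_central : tau central = central := by
  simp [tau, central]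

theorem sl2Transpose_lie (a b : sl2) :
    sl2Transpose ⁅a, b⁆ = ⁅sl2Transpose b, sl2Transpose a⁆ := by
  ext1
  simp [sl2Transpose, Ring.lie_def, Matrix.transpose_mul]

theorem trForm_transpose (a b : sl2) :
    trForm (sl2Transpose a) (sl2Transpose b) = trForm a b := by
  simp only [trForm_apply, sl2Transpose, LinearMap.coe_mk, AddHom.coe_mk,
    ← Matrix.transpose_mul, Matrix.trace_transpose]
  exact Matrix.trace_mul_comm _ _

theorem tau_lie (x y : Affine) : tau ⁅x, y⁆ = ⁅tau y, tau x⁆ := by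
  induction x using affine_induction with
  | hc => rw [tau_central, lie_central, ← lie_skew, lie_central, neg_zero, map_zero]
  | hadd x₁ x₂ h₁ h₂ => rw [add_lie, map_add, h₁, h₂, map_add, lie_add]
  | hsmul r x₁ h₁ => rw [smul_lie, map_smul, h₁, map_smul, lie_smul]
  | hl i a =>
    induction y using affine_induction with
    | hc => rw [tau_central, lie_central, ← lie_skew, lie_central, neg_zero, map_zero]
    | hadd x₁ x₂ h₁ h₂ => rw [lie_add, map_add, h₁, h₂, map_add, add_lie]
    | hsmul r x₁ h₁ => rw [lie_smul, map_smul, h₁, map_smul, smul_lie]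
    | hl j b =>
      rw [tau_loop, tau_loop, lie_loop, lie_loop, map_add, map_smul, tau_loop, tau_central,
        sl2Transpose_lie, trForm_transpose, trForm_apply, trForm_apply,
        Matrix.trace_mul_comm a.1 b.1]
      by_cases hij : i + j = 0
      · obtain rfl : j = -i := by omega
        simp
      · rw [if_neg hij, if_neg (by omega), neg_add_rev]

theorem lie_chevE_chevF_self (i : Fin 2) : ⁅chevE i, chevF i⁆ = chevH i := by
  fin_cases i
  · simp [chevE, chevF, chevH, lie_loop, lie_E_F]
  · have h1 : ⁅sl2F, sl2E⁆ = -sl2H := by rw [← lie_skew, lie_E_F]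
    have h2 : trForm sl2F sl2E = 1 := by
      simp [trForm_apply, sl2E, sl2F, Matrix.trace_fin_two]
    simp [chevE, chevF, chevH, lie_loop, h1, h2]
    abel

theorem lie_chevE_chevF_of_ne {i j : Fin 2} (hij : i ≠ j) : ⁅chevE i, chevF j⁆ = 0 := by
  have h1 : trForm sl2E sl2E = 0 := by simp [trForm_apply, sl2E, Matrix.trace_fin_two]
  have h2 : trForm sl2F sl2F = 0 := by simp [trForm_apply, sl2F, Matrix.trace_fin_two]
  fin_cases i <;> fin_cases j <;> simp_all [chevE, chevF, lie_loop]

theorem lie_chevH_chevF (i j : Fin 2) : ∃ r : ℂ, ⁅chevH i, chevF j⁆ = r • chevF j := by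
  have h1 : trForm sl2H sl2E = 0 := by
    simp [trForm_apply, sl2E, sl2H, Matrix.trace_fin_two]
  have h2 : trForm sl2H sl2F = 0 := by
    simp [trForm_apply, sl2F, sl2H, Matrix.trace_fin_two]
  have h3 : ∀ x : Affine, ⁅central, x⁆ = 0 := fun x => by rw [← lie_skew, lie_central, neg_zero]
  fin_cases i <;> fin_cases j
  · exact ⟨-2, by simp [chevH, chevF, lie_loop, lie_H_F]⟩
  · exact ⟨2, by simp [chevH, chevF, lie_loop, lie_H_E]⟩
  · exact ⟨2, by simp [chevH, chevF, lie_loop, lie_H_F, h3]⟩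
  · exact ⟨-2, by simp [chevH, chevF, lie_loop, lie_H_E, h3]⟩

/-- The Chevalley generators `eᵢ`, `fᵢ` generate the affine Lie algebra. -/
theorem mem_of_chev_mem (K : LieSubalgebra ℂ Affine) (hE : ∀ i, chevE i ∈ K)
    (hF : ∀ i, chevF i ∈ K) (x : Affine) : x ∈ K := by
  have e0 : loop 0 sl2E ∈ K := hE 0
  have f1 : loop 1 sl2F ∈ K := hE 1
  have f0 : loop 0 sl2F ∈ K := hF 0
  have e1 : loop (-1) sl2E ∈ K := hF 1
  have h0 : loop 0 sl2H ∈ K := by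
    have := K.lie_mem e0 f0
    rwa [lie_loop, lie_E_F, add_zero, Int.cast_zero, zero_mul, ite_self, zero_smul,
      add_zero] at this
  have hc : central ∈ K := by
    have := K.lie_mem (hE 1) (hF 1)
    rw [lie_chevE_chevF_self] at this
    have h2 := K.add_mem this h0
    simpa [chevH] using h2
  -- the bracket of two loops lies in `K` if and only if its loop part does
  have red : ∀ (i j : ℤ) (a b : sl2), loop i a ∈ K → loop j b ∈ K → loop (i + j) ⁅a, b⁆ ∈ K := by
    intro i j a b ha hb
    have := K.lie_mem ha hb
    rw [lie_loop] at this
    simpa using K.sub_mem this (K.smul_mem (if i + j = 0 then (i : ℂ) * trForm a b else 0) hc)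
  have hH : ∀ n : ℤ, loop n sl2E ∈ K → loop n sl2H ∈ K := fun n hn => by
    simpa [lie_E_F] using red n 0 _ _ hn f0
  have hH' : ∀ n : ℤ, loop n sl2F ∈ K → loop n sl2H ∈ K := fun n hn => by
    simpa [lie_E_F] using red 0 n _ _ e0 hn
  have stepE : ∀ m n : ℤ, loop m sl2H ∈ K → loop n sl2E ∈ K → loop (m + n) sl2E ∈ K :=
    fun m n hm hn => by
      have := K.smul_mem (2⁻¹ : ℂ) (red m n _ _ hm hn)
      simpa [lie_H_E, smul_smul] using this
  have stepF : ∀ m n : ℤ, loop m sl2H ∈ K → loop n sl2F ∈ K → loop (m + n) sl2F ∈ K :=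
    fun m n hm hn => by
      have := K.smul_mem (-2⁻¹ : ℂ) (red m n _ _ hm hn)
      simpa [lie_H_F, smul_smul] using this
  have hp := hH' 1 f1
  have hm := hH (-1) e1
  have all : ∀ n : ℤ, loop n sl2E ∈ K ∧ loop n sl2F ∈ K := by
    intro n
    induction n with
    | zero => exact ⟨e0, f0⟩
    | succ n ih =>
      rw [add_comm]
      exact ⟨stepE 1 n hp ih.1, stepF 1 n hp ih.2⟩
    | pred n ih =>
      rw [sub_eq_add_neg, add_comm]
      exact ⟨stepE (-1) _ hm ih.1, stepF (-1) _ hm ih.2⟩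
  induction x using affine_induction with
  | hc => exact hc
  | hadd x y hx hy => exact K.add_mem hx hy
  | hsmul r x hx => exact K.smul_mem r hx
  | hl n a =>
    rw [sl2_eq a, map_add, map_add, map_smul, map_smul, map_smul]
    exact K.add_mem (K.add_mem (K.smul_mem _ (all n).1) (K.smul_mem _ (all n).2))
      (K.smul_mem _ (hH n (all n).1))

/-! ### Verma modules -/

/-- The universal enveloping algebra of the affine Lie algebra. -/
abbrev U : Type := UniversalEnvelopingAlgebra ℂ Affine

section

attribute [local instance] LieRing.ofAssociativeRing

/-- The inclusion of the affine Lie algebra in its enveloping algebra. -/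
def toU : Affine →ₗ[ℂ] U := (UniversalEnvelopingAlgebra.ι ℂ : Affine →ₗ⁅ℂ⁆ U)

theorem toU_lie (X Y : Affine) : toU ⁅X, Y⁆ = toU X * toU Y - toU Y * toU X :=
  LieHom.map_lie (UniversalEnvelopingAlgebra.ι ℂ : Affine →ₗ⁅ℂ⁆ U) X Y

end

/-- The left ideal generated by `e₁`, `e₂`, `h₁ - M`, `h₂ - (k - M)`. -/
def vermaIdeal (M k : ℂ) : Submodule U U :=
  Submodule.span U ({x | ∃ i, x = toU (chevE i)} ∪
    {x | ∃ i, x = toU (chevH i) - algebraMap ℂ U ((![M, k - M] : Fin 2 → ℂ) i)})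

/-- The Verma module `V(M, k - M)`: the module over the affine Lie algebra generated by a vector
`v` subject to the relations `e₁ v = e₂ v = 0`, `h₁ v = M v`, `h₂ v = (k - M) v`. -/
def Verma (M k : ℂ) : Type := U ⧸ vermaIdeal M k

instance (M k : ℂ) : AddCommGroup (Verma M k) :=
  inferInstanceAs (AddCommGroup (U ⧸ vermaIdeal M k))

instance (M k : ℂ) : Module U (Verma M k) :=
  inferInstanceAs (Module U (U ⧸ vermaIdeal M k))

instance (M k : ℂ) : Module ℂ (Verma M k) :=
  inferInstanceAs (Module ℂ (U ⧸ vermaIdeal M k))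

instance (M k : ℂ) : IsScalarTower ℂ U (Verma M k) :=
  inferInstanceAs (IsScalarTower ℂ U (U ⧸ vermaIdeal M k))

/-- The quotient map from the enveloping algebra to the Verma module. -/
def toVerma (M k : ℂ) : U →ₗ[U] Verma M k := (vermaIdeal M k).mkQ

theorem toVerma_eq_zero {M k : ℂ} {x : U} (hx : x ∈ vermaIdeal M k) : toVerma M k x = 0 :=
  (Submodule.Quotient.mk_eq_zero _).2 hx

/-- The generating vector `v`. -/
def vac (M k : ℂ) : Verma M k := toVerma M k 1

instance (M k : ℂ) : LieRingModule Affine (Verma M k) where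
  bracket X x := toU X • x
  add_lie X Y x := by simp only [map_add, add_smul]
  lie_add X x y := smul_add _ _ _
  leibniz_lie X Y x := by
    simp only [toU_lie, sub_smul, mul_smul]
    abel

theorem lie_eq_smul {M k : ℂ} (X : Affine) (x : Verma M k) : ⁅X, x⁆ = toU X • x := rfl

instance (M k : ℂ) : LieModule ℂ Affine (Verma M k) where
  smul_lie r X x := by simp only [lie_eq_smul, map_smul, smul_assoc]
  lie_smul r X x := by
    rw [lie_eq_smul, lie_eq_smul, ← algebraMap_smul U r x, ← algebraMap_smul U r (toU X • x),
      ← mul_smul, ← mul_smul, Algebra.commutes]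

theorem chevE_vac (M k : ℂ) (i : Fin 2) : ⁅chevE i, vac M k⁆ = 0 := by
  rw [lie_eq_smul, vac, ← map_smul, smul_eq_mul, mul_one]
  exact toVerma_eq_zero <| Submodule.subset_span (Or.inl ⟨i, rfl⟩)

theorem chevH_vac (M k : ℂ) (i : Fin 2) :
    ⁅chevH i, vac M k⁆ = (![M, k - M] : Fin 2 → ℂ) i • vac M k := by
  have h1 : (![M, k - M] : Fin 2 → ℂ) i • vac M k =
      algebraMap ℂ U ((![M, k - M] : Fin 2 → ℂ) i) • vac M k := by rw [algebraMap_smul]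
  rw [h1, ← sub_eq_zero, lie_eq_smul, ← sub_smul, vac, ← map_smul, smul_eq_mul,
    mul_one]
  exact toVerma_eq_zero <| Submodule.subset_span (Or.inr ⟨i, rfl⟩)

/-- The vector `f_{i₁} ⋯ f_{iₚ} v`. -/
def word (M k : ℂ) : List (Fin 2) → Verma M k
  | [] => vac M k
  | i :: w => ⁅chevF i, word M k w⁆

/-- The homogeneous component `V(M, k - M)_γ`: the span of the vectors `f_{i₁} ⋯ f_{iₚ} v` in
which `f₁` occurs `γ.1` times and `f₂` occurs `γ.2` times. -/
def component (M k : ℂ) (γ : ℕ × ℕ) : Submodule ℂ (Verma M k) :=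
  Submodule.span ℂ {x | ∃ w : List (Fin 2), (w.count 0, w.count 1) = γ ∧ x = word M k w}

theorem word_mem (M k : ℂ) (w : List (Fin 2)) :
    word M k w ∈ component M k (w.count 0, w.count 1) :=
  Submodule.subset_span ⟨w, rfl, rfl⟩

/-- The degree of the generator `fᵢ`. -/
def unitDeg (i : Fin 2) : ℕ × ℕ := if i = 0 then (1, 0) else (0, 1)

theorem count_cons_eq (i : Fin 2) (w : List (Fin 2)) :
    ((i :: w).count 0, (i :: w).count 1) = (w.count 0, w.count 1) + unitDeg i := by
  fin_cases i <;> simp [unitDeg]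

theorem chevF_mem {M k : ℂ} (i : Fin 2) {γ : ℕ × ℕ} {x : Verma M k} (hx : x ∈ component M k γ) :
    ⁅chevF i, x⁆ ∈ component M k (γ + unitDeg i) := by
  induction hx using Submodule.span_induction with
  | mem x hx =>
    obtain ⟨w, rfl, rfl⟩ := hx
    rw [← count_cons_eq]
    exact word_mem M k (i :: w)
  | zero => rw [lie_zero]; exact Submodule.zero_mem _
  | add x y _ _ hx hy => rw [lie_add]; exact Submodule.add_mem _ hx hy
  | smul r x _ hx => rw [lie_smul]; exact Submodule.smul_mem _ _ hx

theorem chevH_word (M k : ℂ) (i : Fin 2) (w : List (Fin 2)) :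
    ∃ r : ℂ, ⁅chevH i, word M k w⁆ = r • word M k w := by
  induction w with
  | nil => exact ⟨_, chevH_vac M k i⟩
  | cons j w ih =>
    obtain ⟨r, hr⟩ := ih
    obtain ⟨s, hs⟩ := lie_chevH_chevF i j
    refine ⟨s + r, ?_⟩
    rw [word, leibniz_lie, hs, hr, smul_lie, lie_smul, add_smul]

theorem chevE_word (M k : ℂ) (i : Fin 2) (w : List (Fin 2)) :
    ⁅chevE i, word M k w⁆ = 0 ∨ ∃ γ, γ + unitDeg i = (w.count 0, w.count 1) ∧
      ⁅chevE i, word M k w⁆ ∈ component M k γ := by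
  induction w with
  | nil => exact Or.inl (chevE_vac M k i)
  | cons j w ih =>
    have h1 : ⁅chevF j, ⁅chevE i, word M k w⁆⁆ = 0 ∨
        ∃ γ, γ + unitDeg i = ((j :: w).count 0, (j :: w).count 1) ∧
          ⁅chevF j, ⁅chevE i, word M k w⁆⁆ ∈ component M k γ := by
      rcases ih with ih | ⟨γ, hγ, ih⟩
      · left; rw [ih, lie_zero]
      · right
        refine ⟨γ + unitDeg j, ?_, chevF_mem j ih⟩
        rw [count_cons_eq, ← hγ]
        abel
    rw [word, leibniz_lie]
    by_cases hij : i = j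
    · subst hij
      obtain ⟨r, hr⟩ := chevH_word M k i w
      right
      refine ⟨(w.count 0, w.count 1), (count_cons_eq i w).symm, ?_⟩
      rw [lie_chevE_chevF_self, hr]
      refine Submodule.add_mem _ (Submodule.smul_mem _ _ (word_mem M k w)) ?_
      rcases h1 with h1 | ⟨γ, hγ, h1⟩
      · rw [h1]; exact Submodule.zero_mem _
      · rw [count_cons_eq, add_left_inj] at hγ
        rwa [← hγ]
    · rw [lie_chevE_chevF_of_ne hij, zero_lie, zero_add]
      exact h1

/-! ### The contragredient dual -/

/-- The action of an element of the affine Lie algebra, as a linear endomorphism. -/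
def op (M k : ℂ) (X : Affine) : Verma M k →ₗ[ℂ] Verma M k where
  toFun x := ⁅X, x⁆
  map_add' := lie_add X
  map_smul' r x := lie_smul r X x

theorem op_apply {M k : ℂ} (X : Affine) (x : Verma M k) : op M k X x = ⁅X, x⁆ := rfl

/-- The restricted dual `V* = ⨁_γ (V_γ)*`, realised as the space of linear functionals on `V` that
vanish on all but finitely many of the components `V_γ`. -/
def restrictedDual (M k : ℂ) : Submodule ℂ (Module.Dual ℂ (Verma M k)) where
  carrier := {φ | {γ : ℕ × ℕ | ∃ x ∈ component M k γ, φ x ≠ 0}.Finite}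
  zero_mem' := by simp
  add_mem' {φ ψ} hφ hψ := by
    refine (hφ.union hψ).subset ?_
    rintro γ ⟨x, hx, hne⟩
    by_cases h0 : φ x = 0
    · exact Or.inr ⟨x, hx, fun h1 => hne (by simp [h0, h1])⟩
    · exact Or.inl ⟨x, hx, h0⟩
  smul_mem' r φ hφ := by
    refine hφ.subset ?_
    rintro γ ⟨x, hx, hne⟩
    exact ⟨x, hx, fun h1 => hne (by simp [h1])⟩

/-- The elements of the affine Lie algebra whose transpose preserves the restricted dual. -/
def dualStabilizer (M k : ℂ) : LieSubalgebra ℂ Affine where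
  carrier := {X | ∀ φ ∈ restrictedDual M k, φ ∘ₗ op M k X ∈ restrictedDual M k}
  zero_mem' φ _ := by
    have : φ ∘ₗ op M k 0 = 0 := LinearMap.ext fun x => by
      rw [LinearMap.comp_apply, op_apply, zero_lie, map_zero, LinearMap.zero_apply]
    rw [this]
    exact Submodule.zero_mem _
  add_mem' {X Y} hX hY φ hφ := by
    have : φ ∘ₗ op M k (X + Y) = φ ∘ₗ op M k X + φ ∘ₗ op M k Y := LinearMap.ext fun x => by
      simp only [LinearMap.comp_apply, op_apply, add_lie, map_add, LinearMap.add_apply]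
    rw [this]
    exact Submodule.add_mem _ (hX φ hφ) (hY φ hφ)
  smul_mem' r X hX φ hφ := by
    have : φ ∘ₗ op M k (r • X) = r • (φ ∘ₗ op M k X) := LinearMap.ext fun x => by
      simp only [LinearMap.comp_apply, op_apply, smul_lie, map_smul, LinearMap.smul_apply]
    rw [this]
    exact Submodule.smul_mem _ _ (hX φ hφ)
  lie_mem' {X Y} hX hY φ hφ := by
    have : φ ∘ₗ op M k ⁅X, Y⁆ = (φ ∘ₗ op M k X) ∘ₗ op M k Y - (φ ∘ₗ op M k Y) ∘ₗ op M k X :=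
      LinearMap.ext fun x => by
        simp only [LinearMap.comp_apply, op_apply, lie_lie, map_sub, LinearMap.sub_apply]
    rw [this]
    exact Submodule.sub_mem _ (hY _ (hX φ hφ)) (hX _ (hY φ hφ))

theorem mem_dualStabilizer (M k : ℂ) (X : Affine) : X ∈ dualStabilizer M k := by
  refine mem_of_chev_mem _ (fun i => ?_) (fun i => ?_) X
  · intro φ hφ
    refine (Set.Finite.image (fun γ => γ + unitDeg i) hφ).subset ?_
    rintro γ ⟨x, hx, hne⟩
    by_contra hcon
    have key : ∀ y ∈ component M k γ, φ ⁅chevE i, y⁆ = 0 := by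
      intro y hy
      induction hy using Submodule.span_induction with
      | mem y hy =>
        obtain ⟨w, rfl, rfl⟩ := hy
        rcases chevE_word M k i w with h0 | ⟨γ, hγ, h0⟩
        · rw [h0, map_zero]
        · by_contra h1
          exact hcon ⟨γ, ⟨_, h0, h1⟩, hγ⟩
      | zero => rw [lie_zero, map_zero]
      | add y z _ _ hy hz => rw [lie_add, map_add, hy, hz, add_zero]
      | smul r y _ hy => rw [lie_smul, map_smul, hy, smul_zero]
    exact hne (key x hx)
  · intro φ hφ
    refine (Set.Finite.preimage (f := fun γ => γ + unitDeg i)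
      (fun _ _ _ _ h => add_right_cancel h) hφ).subset ?_
    rintro γ ⟨x, hx, hne⟩
    exact ⟨_, chevF_mem i hx, hne⟩

/-- The contragredient dual `V(M, k - M)*`. -/
abbrev Contragredient (M k : ℂ) : Type := restrictedDual M k

/-- The action on the contragredient dual: `⟨X φ, x⟩ = ⟨φ, τ(X) x⟩`. -/
instance (M k : ℂ) : LieRingModule Affine (Contragredient M k) where
  bracket X φ := ⟨φ.1 ∘ₗ op M k (tau X), mem_dualStabilizer M k (tau X) φ.1 φ.2⟩
  add_lie X Y φ := Subtype.ext <| LinearMap.ext fun x => by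
    simp only [map_add, LinearMap.comp_apply, op_apply, add_lie, Submodule.coe_add,
      LinearMap.add_apply]
  lie_add X φ ψ := Subtype.ext <| LinearMap.ext fun x => by
    simp only [LinearMap.comp_apply, op_apply, Submodule.coe_add, LinearMap.add_apply]
  leibniz_lie X Y φ := Subtype.ext <| LinearMap.ext fun x => by
    simp only [LinearMap.comp_apply, op_apply, Submodule.coe_add, LinearMap.add_apply, tau_lie,
      lie_lie, map_sub]
    ring

theorem lie_contragredient_apply {M k : ℂ} (X : Affine) (φ : Contragredient M k) (x : Verma M k) :
    (⁅X, φ⁆ : Contragredient M k).1 x = φ.1 ⁅tau X, x⁆ := rfl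

instance (M k : ℂ) : LieModule ℂ Affine (Contragredient M k) where
  smul_lie r X φ := Subtype.ext <| LinearMap.ext fun x => by
    rw [lie_contragredient_apply, map_smul, smul_lie, map_smul]
    rfl
  lie_smul r X φ := Subtype.ext <| LinearMap.ext fun x => rfl

/-- The characterisation of the contragredient module: `⟨fᵢ φ, x⟩ = ⟨φ, eᵢ x⟩` and
`⟨eᵢ φ, x⟩ = ⟨φ, fᵢ x⟩`. -/
theorem contragredient_chev {M k : ℂ} (i : Fin 2) (φ : Contragredient M k) (x : Verma M k) :
    (⁅chevF i, φ⁆ : Contragredient M k).1 x = φ.1 ⁅chevE i, x⁆ ∧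
      (⁅chevE i, φ⁆ : Contragredient M k).1 x = φ.1 ⁅chevF i, x⁆ := by
  have hE : sl2Transpose sl2E = sl2F := by
    ext a b
    fin_cases a <;> fin_cases b <;> simp [sl2Transpose, sl2E, sl2F]
  have hF : sl2Transpose sl2F = sl2E := by
    ext a b
    fin_cases a <;> fin_cases b <;> simp [sl2Transpose, sl2E, sl2F]
  fin_cases i <;> simp [lie_contragredient_apply, chevE, chevF, tau_loop, hE, hF]

/-! ### Dual basis vectors -/

/-- The data `i₁, …, i_a`, `j₁, …, j_b`, `l₁, …, l_c` of an ordered monomial in the elements `f/Tⁱ`,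
`h/Tʲ`, `e/Tˡ`. Only the admissible ones give vectors of the distinguished bases. -/
structure MonomialIndex where
  /-- The exponents `i` of the factors `f/Tⁱ`. -/
  fs : Multiset ℕ
  /-- The exponents `j` of the factors `h/Tʲ`. -/
  hs : Multiset ℕ
  /-- The exponents `l` of the factors `e/Tˡ`. -/
  es : Multiset ℕ

namespace MonomialIndex

/-- The exponents satisfy `i ≥ 0`, `j ≥ 1`, `l ≥ 1`. -/
def Admissible (p : MonomialIndex) : Prop := (∀ j ∈ p.hs, 1 ≤ j) ∧ ∀ l ∈ p.es, 1 ≤ l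

/-- The degree `(p₁, p₂)`, where `p₂ = ∑ i + ∑ j + ∑ l` and `p₁ = p₂ + a - c`. For admissible data
`∑ l ≥ c`, so that the subtraction of natural numbers is not truncated. -/
def degree (p : MonomialIndex) : ℕ × ℕ :=
  (p.fs.sum + p.hs.sum + p.es.sum + p.fs.card - p.es.card, p.fs.sum + p.hs.sum + p.es.sum)

/-- The product of the commuting elements `a/T^n` of the enveloping algebra, for `n` in a multiset,
with the exponents in decreasing order. -/
def factor (a : sl2) (s : Multiset ℕ) : U :=
  ((s.sort (· ≥ ·)).map fun n => toU (loop (-(n : ℤ)) a)).prod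

/-- The monomial vector of the given exponents: `f ⋯ f h ⋯ h e ⋯ e v` if `p₁ ≥ p₂`, and
`e ⋯ e h ⋯ h f ⋯ f v` if `p₁ < p₂`. -/
def vector (M k : ℂ) (p : MonomialIndex) : Verma M k :=
  if p.degree.2 ≤ p.degree.1 then
    (factor sl2F p.fs * factor sl2H p.hs * factor sl2E p.es) • vac M k
  else
    (factor sl2E p.es * factor sl2H p.hs * factor sl2F p.fs) • vac M k

/-- `φ` is the vector `(p.vector)*` of the basis of `V*` dual to the distinguished monomial basis of
`V`: it vanishes on all components of degree other than that of `p`, is `1` on the monomial `p`,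
and `0` on the other monomials of that degree. -/
def IsDual {M k : ℂ} (p : MonomialIndex) (φ : Contragredient M k) : Prop :=
  (∀ γ, γ ≠ p.degree → ∀ x ∈ component M k γ, φ.1 x = 0) ∧
    φ.1 (p.vector M k) = 1 ∧
    ∀ q : MonomialIndex, q.Admissible → q.degree = p.degree → q ≠ p → φ.1 (q.vector M k) = 0

/-- The dual basis vector `(p.vector)*` in `V(M, k - M)*`. -/
def dual (M k : ℂ) (p : MonomialIndex) : Contragredient M k :=
  Classical.epsilon fun φ => p.IsDual φ

end MonomialIndex

/-- The dual basis vector `v*`. -/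
def vacDual (M k : ℂ) : Contragredient M k := MonomialIndex.dual M k ⟨0, 0, 0⟩

/-- The dual basis vector `(f/T^b v)*`. -/
def fDual (M k : ℂ) (b : ℕ) : Contragredient M k := MonomialIndex.dual M k ⟨{b}, 0, 0⟩

/-- The dual basis vector `(f/Tⁱ f/Tʲ v)*`. -/
def ffDual (M k : ℂ) (i j : ℕ) : Contragredient M k := MonomialIndex.dual M k ⟨{i, j}, 0, 0⟩

/-- The dual basis vector `(e/T^b v)*`, for `b ≥ 1`. -/
def eDual (M k : ℂ) (b : ℕ) : Contragredient M k := MonomialIndex.dual M k ⟨0, 0, {b}⟩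

/-- The dual basis vector `(e/Tⁱ e/Tʲ v)*`, for `i, j ≥ 1`. -/
def eeDual (M k : ℂ) (i j : ℕ) : Contragredient M k := MonomialIndex.dual M k ⟨0, 0, {i, j}⟩

/-- The element `a/T^n` of the affine Lie algebra. -/
def overT (a : sl2) (n : ℕ) : Affine := loop (-(n : ℤ)) a

end AffineSl2
end

/-!
The affine Lie algebra is the direct sum of the negative part, with basis `f/T^n` (`n ≥ 0`),
`h/T^n` and `e/T^n` (`n ≥ 1`), and the Borel subalgebra, on which `v` spans a one-dimensional
module with a character `χ`. The first task is the Poincaré–Birkhoff–Witt theorem for the Verma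
module: for every order of the basis of the negative part, the ordered monomials applied to `v` are
a basis. For this, an action of the Lie algebra is constructed on the space of formal monomials
(`InducedModule.act`), by recursion on the number of factors: a basis element which is not larger
than the smallest factor `j` of a monomial `j t` is put in front, and any other one, `u`, acts by
`u (j t) = j (u t) + [u, j] t`. The bracket relation follows by induction from the Jacobi identity
(`InducedModule.act_rel`). The action on the empty monomial defines a map from the Verma module to
the space of formal monomials, inverse to the map sending a formal monomial to the corresponding
vector (`AffineSl2.vermaBasis`). As the action is homogeneous (`InducedModule.act_mem_weight`), the
dual basis vectors are the coordinate functionals of the order `f h e` or `e h f`, depending on the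
degree (`MonomialIndex.existsUnique_isDual`).

The two recursions are treated together (`coordDual_recursion`), for an order of the roots whose
first root `r` is `f` or `e`; let `x_n` be the elements of the negative part with root `r`, the
first of which is `x_0`. Both sides of the recursion for `b` are homogeneous, and all monomials of
their degree have a factor `x_i` with `i ≤ b`, so it suffices to evaluate at vectors `x_i y`. As
the `x_n` commute with each other and come first in the ordered monomials, the coordinate
functionals have simple values on such vectors: `v*` vanishes, the dual vector of `x_j v` gives
`v* (y)` if `i = j` and `0` otherwise, and the sum of the dual vectors of `x_i' x_j' v` with
`i' + j' = m` gives the value at `y` of the dual vector of `x_(m - i) v`. Commuting the operators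
past `x_i`, all terms cancel for `i < b` (`recursion_first`), and for `i = b` there remains a
multiple of `v* (y)`, with the scalar that stands on the left-hand side.
-/

noncomputable section

/-! ### Modules induced from a character of a subalgebra -/

namespace InducedModule

open Finsupp

section Filtration

variable {K N M : Type*} [CommRing K] [AddCommGroup M] [Module K M]

theorem mem_of_supported {P : Set (Multiset N)} {f : (Multiset N →₀ K) →ₗ[K] M}
    {Q : Submodule K M} (h : ∀ s ∈ P, f (single s 1) ∈ Q) {x : Multiset N →₀ K}
    (hx : x ∈ supported K K P) : f x ∈ Q := by
  rw [supported_eq_span_single] at hx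
  induction hx using Submodule.span_induction with
  | mem x hx => obtain ⟨s, hs, rfl⟩ := hx; exact h s hs
  | zero => simp
  | add x y _ _ hx hy => rw [map_add]; exact Q.add_mem hx hy
  | smul r x _ hx => rw [map_smul]; exact Q.smul_mem r hx

theorem eq_of_supported {P : Set (Multiset N)} {f g : (Multiset N →₀ K) →ₗ[K] M}
    (h : ∀ s ∈ P, f (single s 1) = g (single s 1)) {x : Multiset N →₀ K}
    (hx : x ∈ supported K K P) : f x = g x := by
  have := mem_of_supported (f := f - g) (Q := ⊥)
    (fun s hs => by simp [h s hs]) hx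
  simpa [sub_eq_zero] using this

/-- The span of the monomials with at most `n` factors. -/
def filt (K N : Type*) [CommRing K] (n : ℕ) : Submodule K (Multiset N →₀ K) :=
  supported K K {s | s.card ≤ n}

theorem filt_mono {m n : ℕ} (h : m ≤ n) : filt K N m ≤ filt K N n :=
  supported_mono fun _ hs => le_trans (Set.mem_ofPred.1 hs) h

theorem single_mem_filt {s : Multiset N} {n : ℕ} (h : s.card ≤ n) : single s 1 ∈ filt K N n :=
  single_mem_supported K _ h

/-- A statement about all elements of `g` that is linear in the element can be checked on a
basis. -/
theorem mem_of_basis {ι g : Type*} [AddCommGroup g] [Module K g] (β : Module.Basis ι K g)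
    (f : g →ₗ[K] M) (Q : Submodule K M) (h : ∀ u, f (β u) ∈ Q) (X : g) : f X ∈ Q := by
  have : (⊤ : Submodule K g) ≤ Q.comap f := by
    rw [← β.span_eq, Submodule.span_le]
    rintro _ ⟨u, rfl⟩
    exact h u
  exact this trivial

/-- The leading term of the action of the basis element `u` on the monomial `s`. -/
def top (K : Type*) [CommRing K] {N B : Type*} : N ⊕ B → Multiset N → (Multiset N →₀ K)
  | .inl i, s => single (i ::ₘ s) 1
  | .inr _, _ => 0

theorem top_mem_filt {B : Type*} (u : N ⊕ B) (s : Multiset N) : top K u s ∈ filt K N (s.card + 1) := by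
  cases u with
  | inl i => exact single_mem_filt (by simp)
  | inr b => exact Submodule.zero_mem _

end Filtration

section Recursion

variable {K g N B : Type*} [CommRing K] [LieRing g] [LieAlgebra K g] [LinearOrder N]

theorem exists_min_cons {s : Multiset N} (hs : s ≠ 0) :
    ∃ j t, s = j ::ₘ t ∧ ∀ i ∈ t, j ≤ i := by
  have hp := s.pairwise_sort (· ≤ ·)
  have he := s.sort_eq (· ≤ ·)
  cases hl : s.sort (· ≤ ·) with
  | nil => rw [hl] at he; exact absurd he.symm hs
  | cons j t =>
    rw [hl] at hp he
    exact ⟨j, t, he.symm, fun i hi => List.rel_of_pairwise_cons hp hi⟩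

/-- Induction on the number of factors of a monomial, splitting off its smallest factor. -/
theorem min_induction {p : Multiset N → Prop} (zero : p 0)
    (cons : ∀ j t, (∀ i ∈ t, j ≤ i) → (∀ s, s.card ≤ t.card → p s) → p (j ::ₘ t))
    (s : Multiset N) : p s := by
  induction h : s.card using Nat.strong_induction_on generalizing s with
  | _ n ih =>
    by_cases hs : s = 0
    · exact hs ▸ zero
    · obtain ⟨j, t, rfl, hj⟩ := exists_min_cons hs
      rw [Multiset.card_cons] at h
      exact cons j t hj fun r hr => ih r.card (by omega) r rfl

/-- The basis element `u` has to be moved to the right past `j`: it either lies in the subalgebra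
acting by scalars on the generating vector or is larger than `j`. -/
def Exceeds (j : N) : N ⊕ B → Prop
  | .inl i => j < i
  | .inr _ => True

variable (β : Module.Basis (N ⊕ B) K g) (χ : g →ₗ[K] K)

open Classical in
/-- The action of a basis element on a monomial, in terms of an action `A` on shorter monomials. If
`u` has to pass the smallest factor `j` of `j t`, the rule is `u (j t) = j (u t) + [u, j] t`; here
the leading term `top u t` of `u t` is treated separately, because it is not shorter than `j t`. -/
def actStep (A : g →ₗ[K] (Multiset N →₀ K) →ₗ[K] (Multiset N →₀ K)) (u : N ⊕ B)
    (s : Multiset N) : Multiset N →₀ K :=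
  match s.sort (· ≤ ·) with
  | [] => top K u 0 + (u.elim (fun _ => 0) fun b => χ (β (.inr b))) • single 0 1
  | j :: t =>
    if Exceeds j u then
      top K u s + A (β (.inl j)) (A (β u) (single (t : Multiset N) 1) - top K u t) +
        A ⁅β u, β (.inl j)⁆ (single (t : Multiset N) 1)
    else top K u s

/-- The `n`-th approximation of the action, correct on monomials with fewer than `n` factors. The
recursion on `n` replaces a well-founded recursion on the number of factors. -/
def actAux : ℕ → g →ₗ[K] (Multiset N →₀ K) →ₗ[K] (Multiset N →₀ K)
  | 0 => 0
  | n + 1 => β.constr K fun u => linearCombination K (actStep β χ (actAux n) u)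

/-- The action of `g` on the span of the formal monomials in the basis elements from `N`, where the
other basis elements act on the empty monomial by `χ`. -/
def act : g →ₗ[K] (Multiset N →₀ K) →ₗ[K] (Multiset N →₀ K) :=
  β.constr K fun u =>
    linearCombination K fun s => actAux β χ (s.card + 1) (β u) (single s 1)

theorem actAux_succ (n : ℕ) (u : N ⊕ B) (s : Multiset N) :
    actAux β χ (n + 1) (β u) (single s 1) = actStep β χ (actAux β χ n) u s := by
  rw [actAux, Module.Basis.constr_basis, linearCombination_single, one_smul]

theorem actStep_zero (A : g →ₗ[K] (Multiset N →₀ K) →ₗ[K] (Multiset N →₀ K)) (u : N ⊕ B) :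
    actStep β χ A u 0 =
      top K u 0 + (u.elim (fun _ => 0) fun b => χ (β (.inr b))) • single 0 1 := by
  rw [actStep, Multiset.sort_zero]

theorem actStep_of_exceeds (A : g →ₗ[K] (Multiset N →₀ K) →ₗ[K] (Multiset N →₀ K)) {u : N ⊕ B}
    {j : N} {t : Multiset N} (hj : ∀ i ∈ t, j ≤ i) (hu : Exceeds j u) :
    actStep β χ A u (j ::ₘ t) =
      top K u (j ::ₘ t) + A (β (.inl j)) (A (β u) (single t 1) - top K u t) +
        A ⁅β u, β (.inl j)⁆ (single t 1) := by
  rw [actStep, Multiset.sort_cons _ _ _ hj]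
  simp only [if_pos hu, Multiset.sort_eq]

theorem actStep_of_not_exceeds (A : g →ₗ[K] (Multiset N →₀ K) →ₗ[K] (Multiset N →₀ K))
    {u : N ⊕ B} {j : N} {t : Multiset N} (hj : ∀ i ∈ t, j ≤ i) (hu : ¬ Exceeds j u) :
    actStep β χ A u (j ::ₘ t) = top K u (j ::ₘ t) := by
  rw [actStep, Multiset.sort_cons _ _ _ hj]
  simp only [if_neg hu]

/-- The approximations become stationary, and the action of a basis element agrees with the
multiplication by this element up to terms that have no more factors than the given monomial. -/
theorem actAux_stable (n : ℕ) : ∀ s : Multiset N, s.card < n →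
    (∀ u, actAux β χ n (β u) (single s 1) - top K u s ∈ filt K N s.card) ∧
      ∀ X, actAux β χ (n + 1) X (single s 1) = actAux β χ n X (single s 1) := by
  induction n with
  | zero => intro s hs; exact absurd hs (Nat.not_lt_zero _)
  | succ n ih =>
    have hfilt : ∀ s : Multiset N, s.card < n → ∀ X,
        actAux β χ n X (single s 1) ∈ filt K N (s.card + 1) := fun s hs X =>
      mem_of_basis β ((actAux β χ n).flip (single s 1)) _ (fun u => by
        have := Submodule.add_mem _ (filt_mono (Nat.le_succ _) ((ih s hs).1 u))
          (top_mem_filt u s)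
        simpa using this) X
    have hfilt' : ∀ m < n, ∀ X, ∀ x ∈ filt K N m, actAux β χ n X x ∈ filt K N (m + 1) :=
      fun m hm X x hx => mem_of_supported (fun s hs =>
        filt_mono (Nat.succ_le_succ hs) (hfilt s (lt_of_le_of_lt hs hm) X)) hx
    intro s hs
    by_cases h0 : s = 0
    · subst h0
      refine ⟨fun u => ?_, fun X => ?_⟩
      · rw [actAux_succ, actStep_zero, add_sub_cancel_left]
        exact Submodule.smul_mem _ _ (single_mem_filt le_rfl)
      · refine LinearMap.congr_fun (f := (actAux β χ (n + 1 + 1)).flip (single 0 1))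
          (g := (actAux β χ (n + 1)).flip (single 0 1)) (β.ext fun u => ?_) X
        simp only [LinearMap.flip_apply]
        rw [actAux_succ, actAux_succ, actStep_zero, actStep_zero]
    · obtain ⟨j, t, rfl, hj⟩ := exists_min_cons h0
      rw [Multiset.card_cons] at hs
      have ht : t.card < n := by omega
      refine ⟨fun u => ?_, fun X => ?_⟩
      · rw [actAux_succ]
        by_cases hu : Exceeds j u
        · rw [actStep_of_exceeds β χ _ hj hu, add_assoc, add_sub_cancel_left, Multiset.card_cons]
          exact Submodule.add_mem _ (hfilt' _ ht _ _ ((ih t ht).1 u)) (hfilt t ht _)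
        · rw [actStep_of_not_exceeds β χ _ hj hu, sub_self]
          exact Submodule.zero_mem _
      · refine LinearMap.congr_fun (f := (actAux β χ (n + 1 + 1)).flip (single (j ::ₘ t) 1))
          (g := (actAux β χ (n + 1)).flip (single (j ::ₘ t) 1)) (β.ext fun u => ?_) X
        simp only [LinearMap.flip_apply]
        rw [actAux_succ, actAux_succ]
        by_cases hu : Exceeds j u
        · rw [actStep_of_exceeds β χ _ hj hu, actStep_of_exceeds β χ _ hj hu,
            (ih t ht).2, (ih t ht).2]
          congr 2
          exact eq_of_supported (fun s hs => (ih s (lt_of_le_of_lt hs ht)).2 _) ((ih t ht).1 u)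
        · rw [actStep_of_not_exceeds β χ _ hj hu, actStep_of_not_exceeds β χ _ hj hu]

theorem act_single (X : g) (s : Multiset N) :
    act β χ X (single s 1) = actAux β χ (s.card + 1) X (single s 1) := by
  refine LinearMap.congr_fun (f := (act β χ).flip (single s 1))
    (g := (actAux β χ (s.card + 1)).flip (single s 1)) (β.ext fun u => ?_) X
  simp only [LinearMap.flip_apply]
  rw [act, Module.Basis.constr_basis, linearCombination_single, one_smul]

theorem actAux_eq_act {n : ℕ} (X : g) {s : Multiset N} (hs : s.card < n) :
    actAux β χ n X (single s 1) = act β χ X (single s 1) := by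
  induction n, Nat.succ_le_of_lt hs using Nat.le_induction with
  | base => rw [act_single]
  | succ n hn ih => rw [(actAux_stable β χ n s hn).2, ih hn]

theorem act_sub_top_mem (u : N ⊕ B) (s : Multiset N) :
    act β χ (β u) (single s 1) - top K u s ∈ filt K N s.card := by
  rw [act_single]
  exact (actAux_stable β χ _ s (Nat.lt_succ_self _)).1 u

theorem act_zero_inr (b : B) :
    act β χ (β (.inr b)) (single 0 1) = χ (β (.inr b)) • single 0 1 := by
  rw [act_single, actAux_succ, actStep_zero]
  simp [top]

theorem act_inl (i : N) (s : Multiset N) (h : ∀ j ∈ s, i ≤ j) :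
    act β χ (β (.inl i)) (single s 1) = single (i ::ₘ s) 1 := by
  rw [act_single, actAux_succ]
  by_cases hs : s = 0
  · subst hs
    rw [actStep_zero]
    simp [top]
  · obtain ⟨j, t, rfl, hj⟩ := exists_min_cons hs
    have hij : ¬ Exceeds j (.inl i : N ⊕ B) := not_lt.2 (h j (Multiset.mem_cons_self j t))
    rw [actStep_of_not_exceeds β χ _ hj hij]
    rfl

theorem act_inl_top {j : N} {u : N ⊕ B} {t : Multiset N} (hj : ∀ i ∈ t, j ≤ i)
    (hu : Exceeds j u) : act β χ (β (.inl j)) (top K u t) = top K u (j ::ₘ t) := by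
  cases u with
  | inl i =>
    rw [top, top, act_inl, Multiset.cons_swap]
    intro i' hi'
    rcases Multiset.mem_cons.1 hi' with rfl | hi'
    · exact le_of_lt hu
    · exact hj i' hi'
  | inr b => rw [top, top, map_zero]

/-- The rule characterising the action on a monomial whose smallest factor `j` has to be passed. -/
theorem act_cons {j : N} {u : N ⊕ B} {t : Multiset N} (hj : ∀ i ∈ t, j ≤ i)
    (hu : Exceeds j u) :
    act β χ (β u) (single (j ::ₘ t) 1) =
      act β χ (β (.inl j)) (act β χ (β u) (single t 1)) +
        act β χ ⁅β u, β (.inl j)⁆ (single t 1) := by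
  have h1 : actAux β χ (t.card + 1) (β (.inl j)) (act β χ (β u) (single t 1) - top K u t) =
      act β χ (β (.inl j)) (act β χ (β u) (single t 1) - top K u t) :=
    eq_of_supported (fun s hs => actAux_eq_act β χ _ (Nat.lt_succ_of_le hs))
      (act_sub_top_mem β χ u t)
  rw [act_single, actAux_succ, actStep_of_exceeds β χ _ hj hu, Multiset.card_cons,
    actAux_eq_act β χ _ (Nat.lt_succ_self _), actAux_eq_act β χ _ (Nat.lt_succ_self _), h1,
    map_sub, act_inl_top β χ hj hu]
  abel

/-- If `i` commutes with all `j ≤ i`, then it acts on all monomials by multiplication. -/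
theorem act_inl_of_commute (i : N) (h : ∀ j ≤ i, ⁅β (.inl i), β (.inl j)⁆ = 0)
    (s : Multiset N) : act β χ (β (.inl i)) (single s 1) = single (i ::ₘ s) 1 := by
  induction s using min_induction with
  | zero => exact act_inl β χ i 0 (by simp)
  | cons j t hj ih =>
    rcases lt_or_ge j i with hji | hij
    · rw [act_cons β χ hj (show Exceeds j (.inl i : N ⊕ B) from hji), ih t le_rfl, h j hji.le,
        map_zero, LinearMap.zero_apply, add_zero, act_inl, Multiset.cons_swap]
      intro k hk
      rcases Multiset.mem_cons.1 hk with rfl | hk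
      · exact hji.le
      · exact hj k hk
    · refine act_inl β χ i _ fun k hk => ?_
      rcases Multiset.mem_cons.1 hk with rfl | hk
      · exact hij
      · exact hij.trans (hj k hk)

/-- The bracket relation for `X` and `Y`, evaluated at `x`. -/
def Rel (X Y : g) (x : Multiset N →₀ K) : Prop :=
  act β χ X (act β χ Y x) - act β χ Y (act β χ X x) = act β χ ⁅X, Y⁆ x

variable {β χ}

theorem Rel.symm {X Y : g} {x : Multiset N →₀ K} (h : Rel β χ X Y x) : Rel β χ Y X x := by
  rw [Rel, ← lie_skew, map_neg, LinearMap.neg_apply, ← h, neg_sub]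

theorem Rel.of_supported {X Y : g} {P : Set (Multiset N)}
    (h : ∀ s ∈ P, Rel β χ X Y (single s 1)) {x : Multiset N →₀ K} (hx : x ∈ supported K K P) :
    Rel β χ X Y x :=
  eq_of_supported (f := act β χ X ∘ₗ act β χ Y - act β χ Y ∘ₗ act β χ X) (g := act β χ ⁅X, Y⁆)
    h hx

theorem Rel.of_basis {x : Multiset N →₀ K} (h : ∀ u w, Rel β χ (β u) (β w) x) (X Y : g) :
    Rel β χ X Y x := by
  have key : ∀ u, ∀ Y, Rel β χ (β u) Y x := fun u Y => by
    have := mem_of_basis β (((act β χ (β u)) ∘ₗ (act β χ).flip x) -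
      ((act β χ).flip (act β χ (β u) x)) -
      (act β χ).flip x ∘ₗ (LieModule.toEnd K g g (β u))) ⊥ (fun w => by
        have := h u w
        rw [Rel] at this
        simp [this]) Y
    simpa [sub_eq_zero, Rel] using this
  have := mem_of_basis β (((act β χ).flip (act β χ Y x)) -
      (act β χ Y ∘ₗ (act β χ).flip x) +
      (act β χ).flip x ∘ₗ (LieModule.toEnd K g g Y)) ⊥ (fun w => by
        have := key w Y
        rw [Rel, ← lie_skew, map_neg, LinearMap.neg_apply] at this
        simp [this]) X
  rw [Rel, ← lie_skew, map_neg, LinearMap.neg_apply]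
  simpa [add_eq_zero_iff_eq_neg] using this

theorem Rel.of_exceeds {j : N} {u : N ⊕ B} {s : Multiset N} (hj : ∀ i ∈ s, j ≤ i)
    (hu : Exceeds j u) : Rel β χ (β u) (β (.inl j)) (single s 1) := by
  rw [Rel, act_inl β χ j s hj, act_cons β χ hj hu, add_sub_cancel_left]

theorem Rel.self (X : g) (x : Multiset N →₀ K) : Rel β χ X X x := by
  simp [Rel]

/-- The inductive step of the bracket relation, for two basis elements that both have to pass the
smallest factor `j`: it follows from the relations on shorter monomials and the Jacobi identity. -/
theorem Rel.cons {j : N} {u w : N ⊕ B} {t : Multiset N} (hj : ∀ i ∈ t, j ≤ i)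
    (hu : Exceeds j u) (hw : Exceeds j w)
    (ih : ∀ s : Multiset N, s.card ≤ t.card → ∀ X Y, Rel β χ X Y (single s 1)) :
    Rel β χ (β u) (β w) (single (j ::ₘ t) 1) := by
  -- the relation for a larger basis element and `j` holds on the next layer as well
  have h1 : ∀ u w : N ⊕ B, Exceeds j u → Exceeds j w →
      Rel β χ (β u) (β (.inl j)) (act β χ (β w) (single t 1)) := by
    intro u w hu hw
    have h2 : Rel β χ (β u) (β (.inl j)) (top K w t) := by
      cases w with
      | inl i =>
        refine Rel.of_exceeds (fun k hk => ?_) hu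
        rcases Multiset.mem_cons.1 hk with rfl | hk
        · exact le_of_lt hw
        · exact hj k hk
      | inr b => simp [Rel, top]
    have h3 : Rel β χ (β u) (β (.inl j)) (act β χ (β w) (single t 1) - top K w t) :=
      Rel.of_supported (fun s hs => ih s hs _ _) (act_sub_top_mem β χ w t)
    rw [Rel] at h2 h3 ⊢
    simp only [map_sub] at h3
    rw [← sub_add_cancel (act β χ ⁅β u, β (.inl j)⁆ (act β χ (β w) (single t 1)))
      (act β χ ⁅β u, β (.inl j)⁆ (top K w t)), ← h3, ← h2]
    abel
  have e1 := h1 u w hu hw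
  have e2 := h1 w u hw hu
  have e3 := ih t le_rfl (β u) ⁅β w, β (.inl j)⁆
  have e4 := ih t le_rfl (β w) ⁅β u, β (.inl j)⁆
  have e5 := ih t le_rfl (β u) (β w)
  have e6 := ih t le_rfl ⁅β u, β w⁆ (β (.inl j))
  rw [Rel] at e1 e2 e3 e4 e5 e6 ⊢
  rw [act_inl β χ j t hj] at e6
  rw [act_cons β χ hj hu, act_cons β χ hj hw, map_add, map_add]
  have e7 : act β χ ⁅⁅β u, β w⁆, β (.inl j)⁆ (single t 1) =
      act β χ ⁅β u, ⁅β w, β (.inl j)⁆⁆ (single t 1) -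
        act β χ ⁅β w, ⁅β u, β (.inl j)⁆⁆ (single t 1) := by
    rw [lie_lie, map_sub, LinearMap.sub_apply]
  rw [e7, ← e3, ← e4, ← e5, map_sub] at e6
  rw [sub_eq_iff_eq_add] at e1 e2 e6
  rw [e1, e2, e6]
  abel

/-- The action is a Lie algebra action, provided that `χ` is a character of the subalgebra spanned
by the basis elements in `B`. -/
theorem act_rel (hB : ∀ b b', ⁅β (.inr b), β (.inr b')⁆ ∈ Submodule.span K (Set.range (β ∘ .inr)))
    (hχ : ∀ b b', χ ⁅β (.inr b), β (.inr b')⁆ = 0) (X Y : g) (x : Multiset N →₀ K) :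
    Rel β χ X Y x := by
  have hspan : ∀ X ∈ Submodule.span K (Set.range (β ∘ .inr)),
      act β χ X (single 0 1) = χ X • single 0 1 := by
    intro X hX
    induction hX using Submodule.span_induction with
    | mem X hX => obtain ⟨b, rfl⟩ := hX; exact act_zero_inr β χ b
    | zero => simp
    | add X Y _ _ hX hY => rw [map_add, LinearMap.add_apply, hX, hY, map_add, add_smul]
    | smul r X _ hX => rw [map_smul, LinearMap.smul_apply, hX, map_smul, smul_assoc]
  have key : ∀ s : Multiset N, ∀ X Y, Rel β χ X Y (single s 1) := by
    intro s
    induction s using min_induction with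
    | zero =>
      refine Rel.of_basis ?_
      rintro (i | b) (j | c)
      · rcases lt_trichotomy i j with h | rfl | h
        · exact (Rel.of_exceeds (by simp) (show Exceeds i (.inl j : N ⊕ B) from h)).symm
        · exact Rel.self _ _
        · exact Rel.of_exceeds (by simp) h
      · exact (Rel.of_exceeds (by simp) (show Exceeds i (.inr c : N ⊕ B) from trivial)).symm
      · exact Rel.of_exceeds (by simp) (show Exceeds j (.inr b : N ⊕ B) from trivial)
      · rw [Rel, hspan _ (hB b c), hχ, act_zero_inr, act_zero_inr, map_smul, map_smul,
          act_zero_inr, act_zero_inr, smul_comm, sub_self, zero_smul]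
    | cons j t hj ih =>
      refine Rel.of_basis ?_
      have hle : ∀ {i : N}, ¬ Exceeds j (.inl i : N ⊕ B) → ∀ k ∈ j ::ₘ t, i ≤ k := by
        intro i hi k hk
        have hij : i ≤ j := not_lt.1 hi
        rcases Multiset.mem_cons.1 hk with rfl | hk
        · exact hij
        · exact hij.trans (hj k hk)
      -- one of the two elements may be placed in front of the monomial without reordering
      have hsmall : ∀ i, ¬ Exceeds j (.inl i : N ⊕ B) → ∀ u : N ⊕ B,
          Exceeds i u ∨ ∃ k, u = .inl k ∧ k ≤ i := by
        rintro i - (k | b)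
        · rcases lt_or_ge i k with h | h
          · exact Or.inl h
          · exact Or.inr ⟨k, rfl, h⟩
        · exact Or.inl trivial
      have hone : ∀ i, ¬ Exceeds j (.inl i : N ⊕ B) → ∀ u : N ⊕ B,
          Rel β χ (β u) (β (.inl i)) (single (j ::ₘ t) 1) := by
        intro i hi u
        rcases hsmall i hi u with hu | ⟨k, rfl, hk⟩
        · exact Rel.of_exceeds (hle hi) hu
        · rcases eq_or_lt_of_le hk with rfl | hk
          · exact Rel.self _ _
          · refine (Rel.of_exceeds (hle fun hjk => hi (lt_trans hjk hk)) ?_).symm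
            exact hk
      intro u w
      by_cases hu : Exceeds j u
      · by_cases hw : Exceeds j w
        · exact Rel.cons hj hu hw ih
        · rcases w with i | b
          · exact hone i hw u
          · exact absurd trivial hw
      · rcases u with i | b
        · exact (hone i hu w).symm
        · exact absurd trivial hu
  exact Rel.of_supported (P := Set.univ) (fun s _ => key s X Y) (by simp)

/-- The weight of a monomial. -/
def weight {Γ : Type*} [AddCommMonoid Γ] (wt : N → Γ) (s : Multiset N) : Γ := (s.map wt).sum

/-- If the bracket and the character are homogeneous, then so is the action. -/
theorem act_mem_weight {Γ : Type*} [AddCommMonoid Γ] (wt : N ⊕ B → Γ)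
    (hwt : ∀ u w, ⁅β u, β w⁆ ∈ Submodule.span K (β '' {v | wt v = wt u + wt w}))
    (hχ : ∀ b, χ (β (.inr b)) = 0 ∨ wt (.inr b) = 0) (s : Multiset N) (u : N ⊕ B) :
    act β χ (β u) (single s 1) ∈
      supported K K {t | weight (wt ∘ .inl) t = wt u + weight (wt ∘ .inl) s} := by
  have htop : ∀ u s, top K u s ∈
      supported K K {t | weight (wt ∘ .inl) t = wt u + weight (wt ∘ .inl) s} := by
    intro u s
    cases u with
    | inl i => exact single_mem_supported K _ (by simp [weight])
    | inr b => exact Submodule.zero_mem _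
  induction s using min_induction generalizing u with
  | zero =>
    cases u with
    | inl i => rw [act_inl β χ i 0 (by simp)]; exact htop (.inl i) 0
    | inr b =>
      rw [act_zero_inr]
      rcases hχ b with h | h
      · rw [h, zero_smul]; exact Submodule.zero_mem _
      · exact Submodule.smul_mem _ _ (single_mem_supported K _ (by simp [h]))
  | cons j t hj ih =>
    have hc : weight (wt ∘ Sum.inl) (j ::ₘ t) = wt (.inl j) + weight (wt ∘ .inl) t := by
      simp [weight]
    by_cases hu : Exceeds j u
    · rw [act_cons β χ hj hu, ← sub_add_cancel (act β χ (β u) (single t 1)) (top K u t), map_add,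
        act_inl_top β χ hj hu]
      refine Submodule.add_mem _ (Submodule.add_mem _ ?_ (htop _ _)) ?_
      · have h1 : act β χ (β u) (single t 1) - top K u t ∈ supported K K ({s | s.card ≤ t.card} ∩
            {s | weight (wt ∘ .inl) s = wt u + weight (wt ∘ .inl) t}) := by
          rw [supported_inter]
          exact ⟨act_sub_top_mem β χ u t, Submodule.sub_mem _ (ih t le_rfl u) (htop u t)⟩
        refine mem_of_supported (fun s hs => ?_) h1
        have h2 := ih s hs.1 (.inl j)
        rw [hs.2] at h2
        rwa [hc, add_left_comm]
      · refine (Submodule.span_le.2 ?_ : Submodule.span K (β '' _) ≤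
          (supported K K {s | weight (wt ∘ Sum.inl) s = wt u + weight (wt ∘ .inl) (j ::ₘ t)}).comap
            ((act β χ).flip (single t 1))) (hwt u (.inl j))
        rintro _ ⟨v, hv, rfl⟩
        have h2 := ih t le_rfl v
        rw [Set.mem_ofPred.1 hv, add_assoc, ← hc] at h2
        exact h2
    · cases u with
      | inl i =>
        rw [act_inl]
        · exact htop (.inl i) _
        · intro k hk
          have hij : i ≤ j := not_lt.1 hu
          rcases Multiset.mem_cons.1 hk with rfl | hk
          · exact hij
          · exact hij.trans (hj k hk)
      | inr b => exact absurd trivial hu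

end Recursion

section Universal

variable {K g N B V : Type*} [CommRing K] [LieRing g] [LieAlgebra K g] [LinearOrder N]
  [AddCommGroup V] [LieRingModule g V] (β : Module.Basis (N ⊕ B) K g)

/-- The ordered monomial `s` in the basis elements from `N`, applied to the vector `v`. -/
def monomial (v : V) (s : Multiset N) : V :=
  (s.sort (· ≤ ·)).foldr (fun i x => ⁅β (.inl i), x⁆) v

theorem monomial_cons (v : V) {j : N} {t : Multiset N} (hj : ∀ i ∈ t, j ≤ i) :
    monomial β v (j ::ₘ t) = ⁅β (.inl j), monomial β v t⁆ := by
  rw [monomial, Multiset.sort_cons _ _ _ hj]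
  rfl

variable [Module K V]

/-- The linear map sending formal monomials to the corresponding vectors. -/
def ofMonomials (v : V) : (Multiset N →₀ K) →ₗ[K] V :=
  linearCombination K (monomial β v)

theorem ofMonomials_single (v : V) (s : Multiset N) :
    ofMonomials β v (single s 1) = monomial β v s := by
  rw [ofMonomials, linearCombination_single, one_smul]

variable [LieModule K g V]

/-- The module of formal monomials maps to every module with a vector on which the basis elements
from `B` act by `χ`. -/
theorem ofMonomials_act (χ : g →ₗ[K] K) {v : V}
    (hv : ∀ b, ⁅β (.inr b), v⁆ = χ (β (.inr b)) • v) (X : g) (x : Multiset N →₀ K) :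
    ofMonomials β v (act β χ X x) = ⁅X, ofMonomials β v x⁆ := by
  let L : g →ₗ[K] V →ₗ[K] V :=
    LinearMap.mk₂ K (fun X x => ⁅X, x⁆) add_lie smul_lie lie_add fun r X x => lie_smul r X x
  have key : ∀ s : Multiset N, ∀ X,
      ofMonomials β v (act β χ X (single s 1)) = ⁅X, ofMonomials β v (single s 1)⁆ := by
    intro s
    induction s using min_induction with
    | zero =>
      refine LinearMap.congr_fun (f := ofMonomials β v ∘ₗ (act β χ).flip (single 0 1))
        (g := L.flip (ofMonomials β v (single 0 1)))
        (β.ext ?_)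
      rintro (i | b)
      · have := monomial_cons β v (j := i) (t := 0) (by simp)
        simpa [L, act_inl β χ i 0, ofMonomials_single] using this
      · simp only [LinearMap.comp_apply, LinearMap.flip_apply, L, LinearMap.mk₂_apply]
        rw [act_zero_inr, map_smul, ofMonomials_single, monomial, Multiset.sort_zero]
        exact (hv b).symm
    | cons j t hj ih =>
      refine LinearMap.congr_fun (f := ofMonomials β v ∘ₗ (act β χ).flip (single (j ::ₘ t) 1))
        (g := L.flip (ofMonomials β v (single (j ::ₘ t) 1)))
        (β.ext fun u => ?_)
      simp only [LinearMap.comp_apply, LinearMap.flip_apply, L, LinearMap.mk₂_apply]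
      by_cases hu : Exceeds j u
      · have h1 : ofMonomials β v (act β χ (β (.inl j)) (top K u t)) =
            ⁅β (.inl j), ofMonomials β v (top K u t)⁆ := by
          rw [act_inl_top β χ hj hu]
          cases u with
          | inl i =>
            rw [top, top, ofMonomials_single, ofMonomials_single, Multiset.cons_swap,
              monomial_cons]
            intro k hk
            rcases Multiset.mem_cons.1 hk with rfl | hk
            · exact le_of_lt hu
            · exact hj k hk
          | inr b => simp [top]
        have h2 : ofMonomials β v
            (act β χ (β (.inl j)) (act β χ (β u) (single t 1) - top K u t)) =
            ⁅β (.inl j), ofMonomials β v (act β χ (β u) (single t 1) - top K u t)⁆ :=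
          eq_of_supported (f := ofMonomials β v ∘ₗ act β χ (β (.inl j)))
            (g := L (β (.inl j)) ∘ₗ ofMonomials β v)
            (fun s hs => ih s hs _) (act_sub_top_mem β χ u t)
        rw [map_sub, map_sub, map_sub, lie_sub, h1, sub_left_inj, ih t le_rfl] at h2
        rw [act_cons β χ hj hu, map_add, h2, ih t le_rfl, ofMonomials_single, ofMonomials_single,
          monomial_cons β v hj, lie_lie]
        abel
      · cases u with
        | inl i =>
          have hi : ∀ k ∈ j ::ₘ t, i ≤ k := by
            intro k hk
            have hij : i ≤ j := not_lt.1 hu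
            rcases Multiset.mem_cons.1 hk with rfl | hk
            · exact hij
            · exact hij.trans (hj k hk)
          rw [act_inl β χ i _ hi, ofMonomials_single, ofMonomials_single, monomial_cons β v hi]
        | inr b => exact absurd trivial hu
  exact eq_of_supported (P := Set.univ) (f := ofMonomials β v ∘ₗ act β χ X)
    (g := L X ∘ₗ ofMonomials β v) (fun s _ => key s X) (by simp)

end Universal

end InducedModule

namespace AffineSl2

open scoped TensorProduct
open Finsupp InducedModule

/-! ### A basis adapted to the triangular decomposition -/

/-- The basis vectors `f`, `h`, `e` of `sl₂`, in this order. -/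
def root : Fin 3 → sl2 := ![sl2F, sl2H, sl2E]

/-- The number of factors `f` minus the number of factors `e` in `root r`. -/
def rootWt : Fin 3 → ℤ := ![1, 0, -1]

/-- The smallest `n` such that `root r / T^n` belongs to the negative part. -/
def low : Fin 3 → ℕ := ![0, 1, 1]

/-- The basis `f`, `h`, `e` of `sl₂`. -/
def sl2Basis : Module.Basis (Fin 3) ℂ sl2 :=
  Module.Basis.ofEquivFun
    { toFun := fun a => ![a.1 1 0, a.1 0 0, a.1 0 1]
      map_add' := fun a b => by ext i; fin_cases i <;> simp
      map_smul' := fun r a => by ext i; fin_cases i <;> simp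
      invFun := fun c => c 0 • sl2F + c 1 • sl2H + c 2 • sl2E
      left_inv := fun a => by
        conv_rhs => rw [sl2_eq a]
        simp
        abel
      right_inv := fun c => by
        ext i
        fin_cases i <;> simp [sl2E, sl2F, sl2H] }

theorem sl2Basis_apply (r : Fin 3) : sl2Basis r = root r := by
  rw [sl2Basis, Module.Basis.coe_ofEquivFun]
  fin_cases r <;> simp [root]

/-- The affine Lie algebra as a vector space. -/
def affineEquiv : (LoopSl2 × ℂ) ≃ₗ[ℂ] Affine :=
  (LinearEquiv.prodCongr (LinearEquiv.refl ℂ _) (TrivialLieModule.equiv ℂ LoopSl2 ℂ).symm).trans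
    { LieAlgebra.ofProd cocycle with
      map_add' := fun x y => LieAlgebra.of_add cocycle x y
      map_smul' := fun r x => LieAlgebra.of_smul cocycle r x }

/-- The basis of the affine Lie algebra consisting of the `f Tⁿ`, `h Tⁿ`, `e Tⁿ` and of `c`. -/
def affineBasis : Module.Basis ((ℤ × Fin 3) ⊕ Unit) ℂ Affine :=
  (((AddMonoidAlgebra.basis ℤ ℂ).tensorProduct sl2Basis).prod
    (Module.Basis.singleton Unit ℂ)).map affineEquiv

theorem affineBasis_inl (n : ℤ) (r : Fin 3) : affineBasis (.inl (n, r)) = loop n (root r) := by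
  simp [affineBasis, affineEquiv, loop, sl2Basis_apply]

theorem affineBasis_inr (x : Unit) : affineBasis (.inr x) = central := by
  simp [affineBasis, affineEquiv, central]

theorem root_lie (r s : Fin 3) : ∃ (a : ℂ) (t : Fin 3), ⁅root r, root s⁆ = a • root t ∧
    (a = 0 ∨ rootWt t = rootWt r + rootWt s ∧ r ≠ s) := by
  have h1 : ⁅sl2F, sl2E⁆ = (-1 : ℂ) • sl2H := by rw [← lie_skew, lie_E_F, neg_one_smul]
  have h2 : ⁅sl2E, sl2H⁆ = (-2 : ℂ) • sl2E := by rw [← lie_skew, lie_H_E, neg_smul]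
  have h3 : ⁅sl2F, sl2H⁆ = (2 : ℂ) • sl2F := by rw [← lie_skew, lie_H_F, neg_smul, neg_neg]
  have h4 : ⁅sl2E, sl2F⁆ = (1 : ℂ) • sl2H := by rw [lie_E_F, one_smul]
  by_cases hrs : r = s
  · exact ⟨0, 0, by rw [hrs, lie_self, zero_smul], Or.inl rfl⟩
  fin_cases r <;> fin_cases s
  · exact absurd rfl hrs
  · exact ⟨_, 0, h3, Or.inr (by decide)⟩
  · exact ⟨_, 1, h1, Or.inr (by decide)⟩
  · exact ⟨_, 0, lie_H_F, Or.inr (by decide)⟩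
  · exact absurd rfl hrs
  · exact ⟨_, 2, lie_H_E, Or.inr (by decide)⟩
  · exact ⟨_, 1, h4, Or.inr (by decide)⟩
  · exact ⟨_, 2, h2, Or.inr (by decide)⟩
  · exact absurd rfl hrs

theorem trForm_root (r s : Fin 3) :
    trForm (root r) (root s) = 0 ∨ rootWt r + rootWt s = 0 := by
  fin_cases r <;> fin_cases s <;>
    simp [rootWt, root, trForm_apply, sl2E, sl2F, sl2H, Matrix.trace_fin_two]

/-- The degrees of the basis elements: `f₁` and `f₂` have the degrees `(1, 0)` and `(0, 1)`. -/
def basisWt : (ℤ × Fin 3) ⊕ Unit → ℤ × ℤ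
  | .inl (n, r) => (rootWt r - n, -n)
  | .inr _ => 0

/-- The bracket is homogeneous. -/
theorem affineBasis_lie (x y : (ℤ × Fin 3) ⊕ Unit) :
    ⁅affineBasis x, affineBasis y⁆ ∈
      Submodule.span ℂ (affineBasis '' {z | basisWt z = basisWt x + basisWt y}) := by
  rcases x with ⟨m, r⟩ | x
  · rcases y with ⟨n, s⟩ | y
    · rw [affineBasis_inl, affineBasis_inl, lie_loop]
      refine Submodule.add_mem _ ?_ ?_
      · obtain ⟨a, t, hat, ha⟩ := root_lie r s
        rw [hat, map_smul]
        rcases ha with rfl | ⟨ha, -⟩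
        · rw [zero_smul]; exact Submodule.zero_mem _
        · refine Submodule.smul_mem _ _ (Submodule.subset_span ⟨.inl (m + n, t), ?_, ?_⟩)
          · simp only [Set.mem_ofPred_eq, basisWt, Prod.mk_add_mk, Prod.mk.injEq]
            constructor <;> omega
          · rw [affineBasis_inl]
      · split_ifs with hmn
        · rcases trForm_root r s with h | h
          · rw [h, mul_zero, zero_smul]; exact Submodule.zero_mem _
          · refine Submodule.smul_mem _ _ (Submodule.subset_span ⟨.inr (), ?_, ?_⟩)
            · simp only [Set.mem_ofPred_eq, basisWt, Prod.mk_add_mk, Prod.zero_eq_mk, Prod.mk.injEq]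
              constructor <;> omega
            · rw [affineBasis_inr]
        · rw [zero_smul]; exact Submodule.zero_mem _
    · rw [affineBasis_inr, lie_central]; exact Submodule.zero_mem _
  · rw [affineBasis_inr, ← lie_skew, lie_central, neg_zero]; exact Submodule.zero_mem _

/-- The character of the Borel subalgebra defining the Verma module, extended by zero. -/
def borelChar (M k : ℂ) : Affine →ₗ[ℂ] ℂ :=
  affineBasis.constr ℂ (Sum.elim (fun x => if x = (0, 1) then M else 0) fun _ => k)

theorem borelChar_loop (M k : ℂ) (n : ℤ) (r : Fin 3) :
    borelChar M k (loop n (root r)) = if (n, r) = (0, 1) then M else 0 := by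
  rw [← affineBasis_inl, borelChar, Module.Basis.constr_basis, Sum.elim_inl]

theorem borelChar_central (M k : ℂ) : borelChar M k central = k := by
  rw [← affineBasis_inr (), borelChar, Module.Basis.constr_basis, Sum.elim_inr]

/-- The index set of the basis of the negative part: the pair `(r, n)` stands for
`root (σ r) / T^(n + low (σ r))`. The order is the one in which the factors of a monomial are
written, so larger exponents come first. -/
abbrev NegIndex : Type := Fin 3 ×ₗ ℕᵒᵈ

/-- The index set of the basis of the Borel subalgebra: the pair `(n, r)` stands for the element
`root r * T^(n + 1 - low r)`, the other element for `c`. -/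
abbrev BorelIndex : Type := (ℕ × Fin 3) ⊕ Unit

/-- The basis elements corresponding to the indices: `σ i` is the root of the factors that stand at
the `i`-th place of the ordered monomials. -/
def splitIndex (σ : Equiv.Perm (Fin 3)) : NegIndex ⊕ BorelIndex → (ℤ × Fin 3) ⊕ Unit
  | .inl x => .inl
      (-((OrderDual.ofDual (ofLex x).2 + low (σ (ofLex x).1) : ℕ) : ℤ), σ (ofLex x).1)
  | .inr (.inl (n, r)) => .inl ((n : ℤ) + (1 - low r), r)
  | .inr (.inr u) => .inr u

theorem low_le (r : Fin 3) : low r ≤ 1 := by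
  fin_cases r <;> decide

theorem low_add_low_le :
    ∀ r s t, rootWt t = rootWt r + rootWt s → r ≠ s → low r + low s ≤ 1 + low t := by
  decide

theorem low_add_low_le_one :
    ∀ r s, rootWt 1 = rootWt r + rootWt s → r ≠ s → low r + low s ≤ 1 := by
  decide

theorem splitIndex_bijective (σ : Equiv.Perm (Fin 3)) : Function.Bijective (splitIndex σ) := by
  constructor
  · rintro (x | ⟨n, r⟩ | u) (y | ⟨m, s⟩ | w) h <;>
      simp only [splitIndex, Sum.inl.injEq, Sum.inr.injEq, Prod.mk.injEq, reduceCtorEq] at h ⊢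
    · obtain ⟨h1, h2⟩ := h
      have h3 := σ.injective h2
      rw [h2] at h1
      refine ofLex.injective (Prod.ext h3 (OrderDual.ofDual.injective ?_))
      omega
    · obtain ⟨h1, h2⟩ := h
      rw [h2] at h1
      omega
    · obtain ⟨h1, h2⟩ := h
      rw [h2] at h1
      omega
    · obtain ⟨h1, rfl⟩ := h
      exact ⟨by omega, rfl⟩
  · rintro (⟨n, r⟩ | u)
    · have hr := low_le r
      rcases le_or_gt (1 - (low r : ℤ)) n with h | h
      · refine ⟨.inr (.inl ((n - (1 - low r)).toNat, r)), ?_⟩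
        simp only [splitIndex, Sum.inl.injEq, Prod.mk.injEq, and_true]
        omega
      · refine ⟨.inl (toLex (σ.symm r, OrderDual.toDual (-n - low r).toNat)), ?_⟩
        simp only [splitIndex, ofLex_toLex, Equiv.apply_symm_apply, OrderDual.ofDual_toDual,
          Sum.inl.injEq, Prod.mk.injEq, and_true]
        omega
    · exact ⟨.inr (.inr u), rfl⟩

/-- The basis of the affine Lie algebra, split into the negative part and the Borel subalgebra. -/
def splitBasis (σ : Equiv.Perm (Fin 3)) : Module.Basis (NegIndex ⊕ BorelIndex) ℂ Affine :=
  affineBasis.reindex (Equiv.ofBijective _ (splitIndex_bijective σ)).symm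

theorem splitBasis_eq (σ : Equiv.Perm (Fin 3)) (x : NegIndex ⊕ BorelIndex) :
    splitBasis σ x = affineBasis (splitIndex σ x) := by
  rw [splitBasis, Module.Basis.reindex_apply, Equiv.symm_symm, Equiv.ofBijective_apply]

theorem splitBasis_neg (σ : Equiv.Perm (Fin 3)) (r : Fin 3) (n : ℕ) :
    splitBasis σ (.inl (toLex (r, OrderDual.toDual n))) =
      overT (root (σ r)) (n + low (σ r)) := by
  rw [splitBasis_eq, splitIndex, affineBasis_inl]
  rfl

theorem splitBasis_pos (σ : Equiv.Perm (Fin 3)) (r : Fin 3) (n : ℕ) :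
    splitBasis σ (.inr (.inl (n, r))) = loop ((n : ℤ) + (1 - low r)) (root r) := by
  rw [splitBasis_eq, splitIndex, affineBasis_inl]

theorem splitBasis_central (σ : Equiv.Perm (Fin 3)) (u : Unit) :
    splitBasis σ (.inr (.inr u)) = central := by
  rw [splitBasis_eq, splitIndex, affineBasis_inr]

theorem splitBasis_lie (σ : Equiv.Perm (Fin 3)) (x y : NegIndex ⊕ BorelIndex) :
    ⁅splitBasis σ x, splitBasis σ y⁆ ∈ Submodule.span ℂ (splitBasis σ ''
      {z | basisWt (splitIndex σ z) = basisWt (splitIndex σ x) + basisWt (splitIndex σ y)}) := by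
  rw [splitBasis_eq, splitBasis_eq]
  refine Submodule.span_mono ?_ (affineBasis_lie _ _)
  rintro _ ⟨z, hz, rfl⟩
  obtain ⟨w, rfl⟩ := (splitIndex_bijective σ).2 z
  exact ⟨w, hz, splitBasis_eq σ w⟩

theorem loop_mem_borel (σ : Equiv.Perm (Fin 3)) {n : ℤ} {r : Fin 3} (h : 1 - (low r : ℤ) ≤ n) :
    loop n (root r) ∈ Submodule.span ℂ (Set.range (splitBasis σ ∘ .inr)) := by
  refine Submodule.subset_span ⟨.inl ((n - (1 - low r)).toNat, r), ?_⟩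
  rw [Function.comp_apply, splitBasis_pos]
  congr 2
  omega

theorem central_mem_borel (σ : Equiv.Perm (Fin 3)) :
    central ∈ Submodule.span ℂ (Set.range (splitBasis σ ∘ .inr)) :=
  Submodule.subset_span ⟨.inr (), splitBasis_central σ ()⟩

/-- The commutators of the Borel subalgebra lie in it and are killed by its character. -/
theorem borel_lie (σ : Equiv.Perm (Fin 3)) (M k : ℂ) (x y : BorelIndex) :
    ⁅splitBasis σ (.inr x), splitBasis σ (.inr y)⁆ ∈
        Submodule.span ℂ (Set.range (splitBasis σ ∘ .inr)) ∧
      borelChar M k ⁅splitBasis σ (.inr x), splitBasis σ (.inr y)⁆ = 0 := by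
  rcases x with ⟨m, r⟩ | x
  · rcases y with ⟨n, s⟩ | y
    · rw [splitBasis_pos, splitBasis_pos, lie_loop]
      have hr := low_le r
      have hs := low_le s
      -- the cocycle vanishes: the exponents are nonnegative, and zero if their sum is zero
      have h0 : (if (m : ℤ) + (1 - low r) + (n + (1 - low s)) = 0 then
          (((m : ℤ) + (1 - low r) : ℤ) : ℂ) * trForm (root r) (root s) else 0) = 0 := by
        split_ifs with h
        · have : (m : ℤ) + (1 - low r) = 0 := by omega
          rw [this, Int.cast_zero, zero_mul]
        · rfl
      rw [h0, zero_smul, add_zero]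
      obtain ⟨a, t, hat, ha⟩ := root_lie r s
      rw [hat, map_smul]
      rcases ha with rfl | ⟨ha, hrs⟩
      · simp
      · rw [map_smul, borelChar_loop, if_neg, smul_zero]
        · refine ⟨Submodule.smul_mem _ _ (loop_mem_borel σ ?_), rfl⟩
          have := low_add_low_le r s t ha hrs
          omega
        · rw [Prod.mk.injEq]
          rintro ⟨h, rfl⟩
          have := low_add_low_le_one r s ha hrs
          omega
    · rw [splitBasis_central, lie_central]
      exact ⟨Submodule.zero_mem _, map_zero _⟩
  · rw [splitBasis_central, ← lie_skew, lie_central, neg_zero]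
    exact ⟨Submodule.zero_mem _, map_zero _⟩

theorem borelChar_eq_zero_or (σ : Equiv.Perm (Fin 3)) (M k : ℂ) (x : BorelIndex) :
    borelChar M k (splitBasis σ (.inr x)) = 0 ∨ basisWt (splitIndex σ (.inr x)) = 0 := by
  rcases x with ⟨n, r⟩ | x
  · rw [splitBasis_pos, borelChar_loop]
    split_ifs with h
    · right
      rw [Prod.mk.injEq] at h
      rw [splitIndex, h.1, h.2]
      rfl
    · exact Or.inl rfl
  · exact Or.inr rfl

/-! ### The monomial bases of the Verma module -/

/-- The space of formal monomials in the basis of the negative part. -/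
abbrev Monomials : Type := Multiset NegIndex →₀ ℂ

/-- The action of the affine Lie algebra on formal monomials. -/
def monAct (σ : Equiv.Perm (Fin 3)) (M k : ℂ) : Affine →ₗ[ℂ] Monomials →ₗ[ℂ] Monomials :=
  act (splitBasis σ) (borelChar M k)

theorem monAct_lie (σ : Equiv.Perm (Fin 3)) (M k : ℂ) (X Y : Affine) (x : Monomials) :
    monAct σ M k ⁅X, Y⁆ x =
      monAct σ M k X (monAct σ M k Y x) - monAct σ M k Y (monAct σ M k X x) :=
  Eq.symm <|
    act_rel (fun x y => (borel_lie σ M k x y).1) (fun x y => (borel_lie σ M k x y).2) X Y x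

theorem monAct_borel (σ : Equiv.Perm (Fin 3)) (M k : ℂ) {X : Affine}
    (hX : X ∈ Submodule.span ℂ (Set.range (splitBasis σ ∘ .inr))) :
    monAct σ M k X (single 0 1) = borelChar M k X • single 0 1 := by
  induction hX using Submodule.span_induction with
  | mem X hX => obtain ⟨b, rfl⟩ := hX; exact act_zero_inr _ _ b
  | zero => simp
  | add X Y _ _ hX hY => rw [map_add, LinearMap.add_apply, hX, hY, map_add, add_smul]
  | smul r X _ hX => rw [map_smul, LinearMap.smul_apply, hX, map_smul, smul_assoc]

section

attribute [local instance] LieRing.ofAssociativeRing LieAlgebra.ofAssociativeAlgebra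

/-- The representation of the enveloping algebra on formal monomials. -/
def monRep (σ : Equiv.Perm (Fin 3)) (M k : ℂ) : U →ₐ[ℂ] Module.End ℂ Monomials :=
  UniversalEnvelopingAlgebra.lift ℂ
    { monAct σ M k with
      map_lie' := fun {X Y} => LinearMap.ext fun x => monAct_lie σ M k X Y x }

theorem monRep_toU (σ : Equiv.Perm (Fin 3)) (M k : ℂ) (X : Affine) :
    monRep σ M k (toU X) = monAct σ M k X :=
  UniversalEnvelopingAlgebra.lift_ι_apply ℂ _ X

theorem adjoin_range_toU : Algebra.adjoin ℂ (Set.range toU) = ⊤ := by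
  have h1 : Function.Surjective (UniversalEnvelopingAlgebra.mkAlgHom ℂ Affine) :=
    RingCon.mkₐ_surjective _
  have h2 := congrArg (Subalgebra.map (UniversalEnvelopingAlgebra.mkAlgHom ℂ Affine))
    (TensorAlgebra.adjoin_range_ι (R := ℂ) (M := Affine))
  rw [AlgHom.map_adjoin, Algebra.map_top, (AlgHom.range_eq_top _).2 h1, ← Set.range_comp] at h2
  exact h2

end

theorem toU_induction {P : U → Prop} (toU : ∀ X, P (toU X)) (algebraMap : ∀ r, P (algebraMap ℂ U r))
    (add : ∀ x y, P x → P y → P (x + y)) (mul : ∀ x y, P x → P y → P (x * y)) (u : U) : P u := by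
  have hu : u ∈ Algebra.adjoin ℂ (Set.range AffineSl2.toU) := by
    rw [adjoin_range_toU]; trivial
  induction hu using Algebra.adjoin_induction with
  | mem x hx => obtain ⟨X, rfl⟩ := hx; exact toU X
  | algebraMap r => exact algebraMap r
  | add x y _ _ hx hy => exact add x y hx hy
  | mul x y _ _ hx hy => exact mul x y hx hy

theorem central_vac (M k : ℂ) : ⁅central, vac M k⁆ = k • vac M k := by
  have h1 := chevH_vac M k 0
  have h2 := chevH_vac M k 1
  simp only [chevH, Matrix.cons_val_zero, Matrix.cons_val_one, sub_lie] at h1 h2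
  rw [h1, sub_eq_iff_eq_add, ← add_smul] at h2
  rw [h2]
  congr 1
  ring

/-- The Borel subalgebra acts on the generating vector by its character. -/
theorem loop_vac (M k : ℂ) {n : ℤ} {r : Fin 3} (h : 1 - (low r : ℤ) ≤ n) :
    ⁅loop n (root r), vac M k⁆ = borelChar M k (loop n (root r)) • vac M k := by
  have red : ∀ (i j : ℤ) (a b : sl2), i + j ≠ 0 → ⁅loop i a, vac M k⁆ = 0 →
      (∃ c : ℂ, ⁅loop j b, vac M k⁆ = c • vac M k) → ⁅loop (i + j) ⁅a, b⁆, vac M k⁆ = 0 := by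
    rintro i j a b hij ha ⟨c, hb⟩
    have := lie_loop i j a b
    rw [if_neg hij, zero_smul, add_zero] at this
    rw [← this, lie_lie, ha, hb, lie_smul, ha, smul_zero, lie_zero, sub_zero]
  have e0 : ⁅loop 0 sl2E, vac M k⁆ = 0 := chevE_vac M k 0
  have f1 : ⁅loop 1 sl2F, vac M k⁆ = 0 := chevE_vac M k 1
  have h0 : ⁅loop 0 sl2H, vac M k⁆ = M • vac M k := chevH_vac M k 0
  have h1 : ⁅loop 1 sl2H, vac M k⁆ = 0 := by
    have := red 1 0 sl2F sl2E (by norm_num) f1 ⟨0, by rw [e0, zero_smul]⟩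
    rwa [← lie_skew, lie_E_F, map_neg, neg_lie, neg_eq_zero] at this
  have he : ∀ n : ℕ, ⁅loop n sl2E, vac M k⁆ = 0 := by
    intro n
    induction n with
    | zero => exact e0
    | succ n ih =>
      have := red 1 n sl2H sl2E (by omega) h1 ⟨0, by rw [ih, zero_smul]⟩
      rw [lie_H_E, map_smul, smul_lie, smul_eq_zero] at this
      rw [Nat.cast_succ, add_comm]
      exact this.resolve_left (by norm_num)
  have hf : ∀ n : ℕ, ⁅loop (n + 1) sl2F, vac M k⁆ = 0 := by
    intro n
    induction n with
    | zero => simpa using f1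
    | succ n ih =>
      have := red 1 (n + 1) sl2H sl2F (by omega) h1 ⟨0, by rw [ih, zero_smul]⟩
      rw [lie_H_F, map_smul, smul_lie, smul_eq_zero] at this
      rw [Nat.cast_succ, add_comm]
      exact this.resolve_left (by norm_num)
  have hh : ∀ n : ℕ, ⁅loop (n + 1) sl2H, vac M k⁆ = 0 := by
    intro n
    have := red (n + 1) 0 sl2F sl2E (by omega) (hf n) ⟨0, by rw [e0, zero_smul]⟩
    rwa [← lie_skew, lie_E_F, map_neg, neg_lie, neg_eq_zero, add_zero] at this
  rw [borelChar_loop]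
  fin_cases r
  · obtain ⟨m, rfl⟩ : ∃ m : ℕ, n = m + 1 := ⟨(n - 1).toNat, by simp [low] at h; omega⟩
    simpa [root] using hf m
  · obtain ⟨m, rfl⟩ : ∃ m : ℕ, n = m := ⟨n.toNat, by simp [low] at h; omega⟩
    cases m with
    | zero => simpa [root] using h0
    | succ m =>
      rw [if_neg (by simp; omega), zero_smul]
      simpa [root] using hh m
  · obtain ⟨m, rfl⟩ : ∃ m : ℕ, n = m := ⟨n.toNat, by simp [low] at h; omega⟩
    simpa [root] using he m

theorem borel_vac (σ : Equiv.Perm (Fin 3)) (M k : ℂ) (x : BorelIndex) :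
    ⁅splitBasis σ (.inr x), vac M k⁆ = borelChar M k (splitBasis σ (.inr x)) • vac M k := by
  rcases x with ⟨n, r⟩ | x
  · rw [splitBasis_pos]
    exact loop_vac M k (by omega)
  · rw [splitBasis_central, borelChar_central, central_vac]

theorem monRep_vermaIdeal (σ : Equiv.Perm (Fin 3)) (M k : ℂ) {u : U} (hu : u ∈ vermaIdeal M k) :
    monRep σ M k u (single 0 1) = 0 := by
  have e0 := monAct_borel σ M k (loop_mem_borel σ (n := 0) (r := 2) (by decide))
  have f1 := monAct_borel σ M k (loop_mem_borel σ (n := 1) (r := 0) (by decide))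
  have h0 := monAct_borel σ M k (loop_mem_borel σ (n := 0) (r := 1) (by decide))
  have hc := monAct_borel σ M k (central_mem_borel σ)
  rw [borelChar_loop] at e0 f1 h0
  rw [borelChar_central] at hc
  induction hu using Submodule.span_induction with
  | mem u hu =>
    rcases hu with ⟨i, rfl⟩ | ⟨i, rfl⟩
    · rw [monRep_toU]
      fin_cases i
      · simpa [root, chevE] using e0
      · simpa [root, chevE] using f1
    · rw [map_sub, AlgHom.commutes, monRep_toU, LinearMap.sub_apply,
        Module.algebraMap_end_apply, sub_eq_zero]
      fin_cases i
      · simpa [root, chevH] using h0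
      · simp only [root, Matrix.cons_val_one, Matrix.cons_val_zero, if_true] at h0
        simp [chevH, h0, hc, sub_smul, -smul_single]
  | zero => simp
  | add x y _ _ hx hy => rw [map_add, LinearMap.add_apply, hx, hy, add_zero]
  | smul u x _ hx => rw [smul_eq_mul, map_mul, Module.End.mul_apply, hx, map_zero]

/-- The linear map from the Verma module to the formal monomials which sends `u v` to the action of
`u` on the empty monomial. -/
def toMonomials (σ : Equiv.Perm (Fin 3)) (M k : ℂ) : Verma M k →ₗ[ℂ] Monomials :=
  ((vermaIdeal M k).restrictScalars ℂ).liftQ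
    ((LinearMap.applyₗ (single 0 1 : Monomials)) ∘ₗ (monRep σ M k).toLinearMap)
    (fun _ hu => monRep_vermaIdeal σ M k hu)

theorem toMonomials_smul_vac (σ : Equiv.Perm (Fin 3)) (M k : ℂ) (u : U) :
    toMonomials σ M k (u • vac M k) = monRep σ M k u (single 0 1) := by
  rw [vac, ← map_smul, smul_eq_mul, mul_one]
  rfl

theorem exists_smul_vac {M k : ℂ} (x : Verma M k) : ∃ u : U, u • vac M k = x := by
  obtain ⟨u, rfl⟩ := (vermaIdeal M k).mkQ_surjective x
  exact ⟨u, by rw [vac, ← map_smul, smul_eq_mul, mul_one]; rfl⟩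

theorem toMonomials_lie (σ : Equiv.Perm (Fin 3)) (M k : ℂ) (X : Affine) (x : Verma M k) :
    toMonomials σ M k ⁅X, x⁆ = monAct σ M k X (toMonomials σ M k x) := by
  obtain ⟨u, rfl⟩ := exists_smul_vac x
  rw [lie_eq_smul, ← mul_smul, toMonomials_smul_vac, toMonomials_smul_vac, map_mul, monRep_toU,
    Module.End.mul_apply]

theorem toMonomials_vac (σ : Equiv.Perm (Fin 3)) (M k : ℂ) :
    toMonomials σ M k (vac M k) = single 0 1 := by
  have := toMonomials_smul_vac σ M k 1
  rwa [one_smul, map_one, Module.End.one_apply] at this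

/-- The vector given by an ordered monomial. -/
def monVec (σ : Equiv.Perm (Fin 3)) (M k : ℂ) (s : Multiset NegIndex) : Verma M k :=
  monomial (splitBasis σ) (vac M k) s

theorem toMonomials_monVec (σ : Equiv.Perm (Fin 3)) (M k : ℂ) (s : Multiset NegIndex) :
    toMonomials σ M k (monVec σ M k s) = single s 1 := by
  induction s using min_induction with
  | zero => rw [monVec, monomial, Multiset.sort_zero]; exact toMonomials_vac σ M k
  | cons j t hj ih =>
    rw [monVec, monomial_cons _ _ hj, toMonomials_lie, ← monVec, ih t le_rfl]
    exact act_inl _ _ j t hj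

/-- The map from formal monomials to the Verma module commutes with the enveloping algebra. -/
theorem ofMonomials_monRep (σ : Equiv.Perm (Fin 3)) (M k : ℂ) (u : U) (x : Monomials) :
    ofMonomials (splitBasis σ) (vac M k) (monRep σ M k u x) =
      u • ofMonomials (splitBasis σ) (vac M k) x := by
  induction u using toU_induction generalizing x with
  | toU X => rw [monRep_toU, ← lie_eq_smul]; exact ofMonomials_act _ _ (borel_vac σ M k) X x
  | algebraMap r =>
    rw [AlgHom.commutes, Module.algebraMap_end_apply, map_smul, algebraMap_smul]
  | add u w hu hw => rw [map_add, LinearMap.add_apply, map_add, hu, hw, add_smul]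
  | mul u w hu hw => rw [map_mul, Module.End.mul_apply, hu, hw, mul_smul]

/-- The ordered monomials form a basis of the Verma module. -/
def vermaBasis (σ : Equiv.Perm (Fin 3)) (M k : ℂ) :
    Module.Basis (Multiset NegIndex) ℂ (Verma M k) :=
  Module.Basis.ofRepr <| LinearEquiv.ofLinearMap (toMonomials σ M k)
    (ofMonomials (splitBasis σ) (vac M k))
    (by
      refine Finsupp.lhom_ext' fun s => LinearMap.ext_ring ?_
      simp only [LinearMap.comp_apply, lsingle_apply, LinearMap.id_apply]
      rw [ofMonomials_single]
      exact toMonomials_monVec σ M k s)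
    (by
      refine LinearMap.ext fun x => ?_
      obtain ⟨u, rfl⟩ := exists_smul_vac x
      rw [LinearMap.comp_apply, toMonomials_smul_vac, ofMonomials_monRep, ofMonomials_single,
        monomial, Multiset.sort_zero]
      rfl)

theorem vermaBasis_repr (σ : Equiv.Perm (Fin 3)) (M k : ℂ) (x : Verma M k) :
    (vermaBasis σ M k).repr x = toMonomials σ M k x := rfl

theorem vermaBasis_apply (σ : Equiv.Perm (Fin 3)) (M k : ℂ) (s : Multiset NegIndex) :
    vermaBasis σ M k s = monVec σ M k s := by
  apply (vermaBasis σ M k).repr.injective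
  rw [Module.Basis.repr_self, vermaBasis_repr, toMonomials_monVec]

/-! ### The grading -/

/-- The degree of a formal monomial. -/
def monWt (σ : Equiv.Perm (Fin 3)) (s : Multiset NegIndex) : ℤ × ℤ :=
  InducedModule.weight (basisWt ∘ splitIndex σ ∘ .inl) s

theorem monAct_mem_weight (σ : Equiv.Perm (Fin 3)) (M k : ℂ) (n : ℤ) (r : Fin 3) {α : ℤ × ℤ}
    {x : Monomials} (hx : x ∈ supported ℂ ℂ {s | monWt σ s = α}) :
    monAct σ M k (loop n (root r)) x ∈
      supported ℂ ℂ {s | monWt σ s = (rootWt r - n, -n) + α} := by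
  obtain ⟨u, hu⟩ := (splitIndex_bijective σ).2 (.inl (n, r))
  refine mem_of_supported (fun s hs => ?_) hx
  have h := act_mem_weight (β := splitBasis σ) (χ := borelChar M k) (basisWt ∘ splitIndex σ)
    (splitBasis_lie σ) (borelChar_eq_zero_or σ M k) s u
  rw [splitBasis_eq, Function.comp_apply, hu, affineBasis_inl] at h
  rw [← Set.mem_ofPred.1 hs]
  exact h

/-- The component of degree `γ` is contained in the span of the ordered monomials of degree `γ`,
whatever the order of the factors is. -/
theorem component_weight (σ : Equiv.Perm (Fin 3)) {M k : ℂ} {γ : ℕ × ℕ} {x : Verma M k}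
    (hx : x ∈ component M k γ) :
    toMonomials σ M k x ∈ supported ℂ ℂ {s | monWt σ s = ((γ.1 : ℤ), (γ.2 : ℤ))} := by
  have key : ∀ w : List (Fin 2), toMonomials σ M k (word M k w) ∈
      supported ℂ ℂ {s | monWt σ s = ((w.count 0 : ℤ), (w.count 1 : ℤ))} := by
    intro w
    induction w with
    | nil =>
      rw [word, toMonomials_vac]
      exact single_mem_supported ℂ _ (by simp [monWt, InducedModule.weight]; rfl)
    | cons i w ih =>
      rw [word, toMonomials_lie]
      fin_cases i
      · have := monAct_mem_weight σ M k 0 0 ih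
        simpa [chevF, root, rootWt, add_comm] using this
      · have := monAct_mem_weight σ M k (-1) 2 ih
        simpa [chevF, root, rootWt, add_comm] using this
  induction hx using Submodule.span_induction with
  | mem x hx => obtain ⟨w, rfl, rfl⟩ := hx; exact key w
  | zero => rw [map_zero]; exact Submodule.zero_mem _
  | add x y _ _ hx hy => rw [map_add]; exact Submodule.add_mem _ hx hy
  | smul r x _ hx => rw [map_smul]; exact Submodule.smul_mem _ _ hx

/-- The words in `f₁` and `f₂` span the Verma module: their span is stable under `eᵢ` and `fᵢ`, and
these generate the affine Lie algebra. -/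
theorem span_range_word (M k : ℂ) : Submodule.span ℂ (Set.range (word M k)) = ⊤ := by
  set Q := Submodule.span ℂ (Set.range (word M k)) with hQ
  have hcomp : ∀ γ, component M k γ ≤ Q := fun γ =>
    Submodule.span_mono (by rintro _ ⟨w, -, rfl⟩; exact ⟨w, rfl⟩)
  let K : LieSubalgebra ℂ Affine :=
    { carrier := {X | ∀ x ∈ Q, ⁅X, x⁆ ∈ Q}
      zero_mem' := fun x _ => by rw [zero_lie]; exact Q.zero_mem
      add_mem' := fun hX hY x hx => by rw [add_lie]; exact Q.add_mem (hX x hx) (hY x hx)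
      smul_mem' := fun r X hX x hx => by rw [smul_lie]; exact Q.smul_mem r (hX x hx)
      lie_mem' := fun hX hY x hx => by
        rw [lie_lie]; exact Q.sub_mem (hX _ (hY x hx)) (hY _ (hX x hx)) }
  have hgen : ∀ X, (∀ w, ⁅X, word M k w⁆ ∈ Q) → X ∈ K := by
    intro X hX x hx
    induction hx using Submodule.span_induction with
    | mem x hx => obtain ⟨w, rfl⟩ := hx; exact hX w
    | zero => rw [lie_zero]; exact Q.zero_mem
    | add x y _ _ hx hy => rw [lie_add]; exact Q.add_mem hx hy
    | smul r x _ hx => rw [lie_smul]; exact Q.smul_mem r hx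
  have hall : ∀ X, X ∈ K := mem_of_chev_mem K
    (fun i => hgen _ fun w => by
      rcases chevE_word M k i w with h | ⟨γ, -, h⟩
      · rw [h]; exact Q.zero_mem
      · exact hcomp γ h)
    (fun i => hgen _ fun w => Submodule.subset_span ⟨i :: w, rfl⟩)
  have hU : ∀ u : U, ∀ x ∈ Q, u • x ∈ Q := by
    intro u
    induction u using toU_induction with
    | toU X => exact hall X
    | algebraMap r => intro x hx; rw [algebraMap_smul]; exact Q.smul_mem r hx
    | add u w hu hw => intro x hx; rw [add_smul]; exact Q.add_mem (hu x hx) (hw x hx)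
    | mul u w hu hw => intro x hx; rw [mul_smul]; exact hu _ (hw x hx)
  rw [eq_top_iff]
  intro x _
  obtain ⟨u, rfl⟩ := exists_smul_vac x
  exact hU u _ (Submodule.subset_span ⟨[], rfl⟩)

/-! ### Ordered monomials -/

/-- The index of the element `root (σ i) / T^(n + low (σ i))`. -/
def negIndex (i : Fin 3) (n : ℕ) : NegIndex := toLex (i, OrderDual.toDual n)

theorem monWt_add (σ : Equiv.Perm (Fin 3)) (s t : Multiset NegIndex) :
    monWt σ (s + t) = monWt σ s + monWt σ t := by
  simp [monWt, InducedModule.weight]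

theorem monWt_cons (σ : Equiv.Perm (Fin 3)) (i : Fin 3) (n : ℕ) (s : Multiset NegIndex) :
    monWt σ (negIndex i n ::ₘ s) =
      (rootWt (σ i) + (n + low (σ i) : ℕ), ((n + low (σ i) : ℕ) : ℤ)) + monWt σ s := by
  simp [monWt, InducedModule.weight, negIndex, basisWt, splitIndex, sub_eq_add_neg]

namespace MonomialIndex

/-- The exponents of the factors `root r / T^n`. -/
def part (p : MonomialIndex) : Fin 3 → Multiset ℕ := ![p.fs, p.hs, p.es]

theorem admissible_iff (p : MonomialIndex) :
    p.Admissible ↔ ∀ r, ∀ n ∈ p.part r, low r ≤ n := by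
  rw [Fin.forall_fin_succ, Fin.forall_fin_two]
  simp [Admissible, part, low]

theorem ext_part {p q : MonomialIndex} (h : ∀ r, p.part r = q.part r) : p = q := by
  obtain ⟨a, b, c⟩ := p
  obtain ⟨a', b', c'⟩ := q
  have h0 := h 0
  have h1 := h 1
  have h2 := h 2
  simp only [part, Matrix.cons_val] at h0 h1 h2
  rw [h0, h1, h2]

/-- The formal monomial with given exponents. For admissible data the subtraction is not
truncated. -/
def toNeg (σ : Equiv.Perm (Fin 3)) (p : MonomialIndex) : Multiset NegIndex :=
  ∑ i, (p.part (σ i)).map fun n => negIndex i (n - low (σ i))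

/-- The exponents of a formal monomial; this is inverse to `toNeg`. -/
def ofNeg (σ : Equiv.Perm (Fin 3)) (s : Multiset NegIndex) : MonomialIndex :=
  let e (r : Fin 3) : Multiset ℕ := (s.filter fun x => σ (ofLex x).1 = r).map fun x =>
    OrderDual.ofDual (ofLex x).2 + low r
  ⟨e 0, e 1, e 2⟩

theorem part_ofNeg (σ : Equiv.Perm (Fin 3)) (s : Multiset NegIndex) (r : Fin 3) :
    (ofNeg σ s).part r = (s.filter fun x => σ (ofLex x).1 = r).map fun x =>
      OrderDual.ofDual (ofLex x).2 + low r := by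
  fin_cases r <;> rfl

theorem ofNeg_admissible (σ : Equiv.Perm (Fin 3)) (s : Multiset NegIndex) :
    (ofNeg σ s).Admissible := by
  rw [admissible_iff]
  intro r n hn
  rw [part_ofNeg, Multiset.mem_map] at hn
  obtain ⟨x, -, rfl⟩ := hn
  exact Nat.le_add_left _ _

theorem toNeg_ofNeg (σ : Equiv.Perm (Fin 3)) (s : Multiset NegIndex) :
    (ofNeg σ s).toNeg σ = s := by
  have h : ∀ i, ((ofNeg σ s).part (σ i)).map (fun n => negIndex i (n - low (σ i))) =
      s.filter fun x => (ofLex x).1 = i := by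
    intro i
    simp only [part_ofNeg, Multiset.map_map, σ.injective.eq_iff]
    rw [Multiset.map_congr rfl (g := id), Multiset.map_id]
    intro x hx
    rw [← (Multiset.mem_filter.1 hx).2, Function.comp_apply, Nat.add_sub_cancel]
    rfl
  rw [toNeg, Finset.sum_congr rfl fun i _ => h i]
  ext x
  simp [Multiset.count_sum', Multiset.count_filter]

theorem ofNeg_toNeg (σ : Equiv.Perm (Fin 3)) {p : MonomialIndex} (hp : p.Admissible) :
    ofNeg σ (p.toNeg σ) = p := by
  rw [admissible_iff] at hp
  refine ext_part fun r => ?_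
  obtain ⟨j, rfl⟩ := σ.surjective r
  have h : ∀ i, ((p.part (σ i)).map fun n => negIndex i (n - low (σ i))).filter
      (fun x => σ (ofLex x).1 = σ j) =
      if i = j then (p.part (σ i)).map fun n => negIndex i (n - low (σ i)) else 0 := by
    intro i
    split_ifs with hij
    · rw [Multiset.filter_eq_self]
      rintro x hx
      obtain ⟨n, -, rfl⟩ := Multiset.mem_map.1 hx
      simp [negIndex, hij]
    · rw [Multiset.filter_eq_nil]
      rintro x hx
      obtain ⟨n, -, rfl⟩ := Multiset.mem_map.1 hx
      simpa [negIndex] using hij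
  have hsum : (p.toNeg σ).filter (fun x => σ (ofLex x).1 = σ j) =
      (p.part (σ j)).map fun n => negIndex j (n - low (σ j)) := by
    rw [← (Finset.sum_ite_eq' Finset.univ j
      fun i => (p.part (σ i)).map fun n => negIndex i (n - low (σ i))).trans
        (if_pos (Finset.mem_univ _)), ← Finset.sum_congr rfl fun i _ => h i, toNeg]
    exact map_sum (⟨⟨Multiset.filter fun x : NegIndex => σ (ofLex x).1 = σ j,
      Multiset.filter_zero _⟩, Multiset.filter_add _⟩ : Multiset NegIndex →+ Multiset NegIndex) _ _
  rw [part_ofNeg, hsum, Multiset.map_map]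
  refine (Multiset.map_congr rfl fun n hn => ?_).trans (Multiset.map_id _)
  simp [negIndex, Nat.sub_add_cancel (hp _ n hn)]

theorem monWt_toNeg (σ : Equiv.Perm (Fin 3)) {p : MonomialIndex} (hp : p.Admissible) :
    monWt σ (p.toNeg σ) = ((p.degree.1 : ℤ), (p.degree.2 : ℤ)) := by
  have h1 : p.es.card ≤ p.es.sum := by
    have := Multiset.card_nsmul_le_sum hp.2
    simpa using this
  rw [admissible_iff] at hp
  have h2 : ∀ i, monWt σ ((p.part (σ i)).map fun n => negIndex i (n - low (σ i))) =
      (rootWt (σ i) * (p.part (σ i)).card + (p.part (σ i)).sum, ((p.part (σ i)).sum : ℤ)) := by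
    intro i
    have := hp (σ i)
    revert this
    induction p.part (σ i) using Multiset.induction with
    | empty => simp [monWt, InducedModule.weight]; rfl
    | cons n t ih =>
      intro this
      rw [Multiset.map_cons, monWt_cons, ih fun m hm => this m (Multiset.mem_cons_of_mem hm),
        Nat.sub_add_cancel (this n (Multiset.mem_cons_self n t))]
      simp only [Prod.mk_add_mk, Multiset.card_cons, Multiset.sum_cons, Prod.mk.injEq]
      push_cast
      exact ⟨by ring, rfl⟩
  have h3 : monWt σ (p.toNeg σ) = ∑ r : Fin 3,
      (rootWt r * (p.part r).card + (p.part r).sum, ((p.part r).sum : ℤ)) := by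
    rw [← Equiv.sum_comp σ, ← Finset.sum_congr rfl fun i _ => h2 i, toNeg, Fin.sum_univ_three,
      Fin.sum_univ_three, monWt_add, monWt_add]
  rw [h3, Fin.sum_univ_three]
  simp only [part, rootWt, degree, Matrix.cons_val, Prod.mk_add_mk, Prod.mk.injEq]
  constructor
  · omega
  · push_cast; ring

/-- The order of the factors in the distinguished monomials of degree `γ`: `f`, `h`, `e` if
`γ.1 ≥ γ.2`, and `e`, `h`, `f` otherwise. -/
def order (γ : ℕ × ℕ) : Equiv.Perm (Fin 3) := if γ.2 ≤ γ.1 then 1 else Fin.revPerm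

theorem sort_toNeg (σ : Equiv.Perm (Fin 3)) (p : MonomialIndex) :
    (p.toNeg σ).sort (· ≤ ·) = (List.finRange 3).flatMap fun i =>
      ((p.part (σ i)).sort (· ≥ ·)).map fun n => negIndex i (n - low (σ i)) := by
  refine List.Perm.eq_of_pairwise (le := (· ≤ ·)) (fun _ _ _ _ => le_antisymm)
    (Multiset.pairwise_sort _ _) ?_ ?_
  · rw [List.pairwise_flatMap]
    constructor
    · intro i _
      rw [List.pairwise_map]
      refine (Multiset.pairwise_sort _ _).imp fun {m n} hmn => ?_
      rw [negIndex, negIndex, Prod.Lex.toLex_le_toLex]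
      exact Or.inr ⟨rfl, OrderDual.toDual_le_toDual.2 (Nat.sub_le_sub_right hmn _)⟩
    · refine (List.pairwise_lt_finRange 3).imp fun {i j} hij => ?_
      rintro x hx y hy
      obtain ⟨m, -, rfl⟩ := List.mem_map.1 hx
      obtain ⟨n, -, rfl⟩ := List.mem_map.1 hy
      rw [negIndex, negIndex, Prod.Lex.toLex_le_toLex]
      exact Or.inl hij
  · rw [← Multiset.coe_eq_coe, Multiset.sort_eq, toNeg, Fin.sum_univ_three]
    have h3 : List.finRange 3 = [0, 1, 2] := by decide
    simp only [h3, List.flatMap_cons, List.flatMap_nil, List.append_nil, ← Multiset.coe_add,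
      ← Multiset.map_coe, Multiset.sort_eq, add_assoc]

/-- In the definition of `factor` the list of exponents is cast to a list of integers. -/
theorem factor_eq (a : sl2) (s : Multiset ℕ) :
    factor a s = ((s.sort (· ≥ ·)).map fun n => toU (overT a n)).prod := by
  rw [factor]
  congr 1
  generalize s.sort (· ≥ ·) = l
  induction l with
  | nil => rfl
  | cons n l ih => rw [List.map_cons, ← ih]; rfl

theorem monVec_toNeg (σ : Equiv.Perm (Fin 3)) (M k : ℂ) {p : MonomialIndex}
    (hp : p.Admissible) : monVec σ M k (p.toNeg σ) =
      (factor (root (σ 0)) (p.part (σ 0)) * factor (root (σ 1)) (p.part (σ 1)) *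
        factor (root (σ 2)) (p.part (σ 2))) • vac M k := by
  rw [admissible_iff] at hp
  have hfold : ∀ (i : Fin 3) (x : Verma M k),
      (((p.part (σ i)).sort (· ≥ ·)).map fun n => negIndex i (n - low (σ i))).foldr
        (fun i x => ⁅splitBasis σ (.inl i), x⁆) x =
      factor (root (σ i)) (p.part (σ i)) • x := by
    intro i x
    have hl : ∀ n ∈ (p.part (σ i)).sort (· ≥ ·), low (σ i) ≤ n := fun n hn =>
      hp _ n ((Multiset.mem_sort _).1 hn)
    rw [factor_eq]
    generalize (p.part (σ i)).sort (· ≥ ·) = l at hl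
    induction l with
    | nil => simp
    | cons n l ih =>
      rw [List.map_cons, List.foldr_cons, ih fun m hm => hl m (List.mem_cons_of_mem _ hm),
        negIndex, splitBasis_neg, Nat.sub_add_cancel (hl n List.mem_cons_self), List.map_cons,
        List.prod_cons, mul_smul, lie_eq_smul]
  have h3 : List.finRange 3 = [0, 1, 2] := by decide
  rw [monVec, monomial, sort_toNeg]
  simp only [h3, List.flatMap_cons, List.flatMap_nil, List.append_nil, List.foldr_append, hfold,
    mul_smul]

theorem vector_eq (M k : ℂ) {p : MonomialIndex} (hp : p.Admissible) :
    p.vector M k = monVec (order p.degree) M k (p.toNeg (order p.degree)) := by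
  rw [monVec_toNeg _ _ _ hp, vector, order]
  split_ifs <;> rfl

end MonomialIndex

/-! ### Dual basis vectors -/

/-- The coordinate functional of the basis of ordered monomials. -/
def coordDual (σ : Equiv.Perm (Fin 3)) (M k : ℂ) (s : Multiset NegIndex) : Contragredient M k :=
  ⟨(vermaBasis σ M k).coord s, by
    refine Set.Subsingleton.finite ?_
    have key : ∀ γ : ℕ × ℕ, (∃ x ∈ component M k γ, (vermaBasis σ M k).coord s x ≠ 0) →
        monWt σ s = ((γ.1 : ℤ), (γ.2 : ℤ)) := by
      rintro γ ⟨x, hx, hne⟩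
      exact (mem_supported ℂ _).1 (component_weight σ hx) (mem_support_iff.2 hne)
    intro γ hγ γ' hγ'
    have := (key γ hγ).symm.trans (key γ' hγ')
    simp only [Prod.mk.injEq, Nat.cast_inj] at this
    exact Prod.ext this.1 this.2⟩

theorem coordDual_apply (σ : Equiv.Perm (Fin 3)) (M k : ℂ) (s : Multiset NegIndex)
    (x : Verma M k) : (coordDual σ M k s).1 x = toMonomials σ M k x s := rfl

theorem coordDual_component (σ : Equiv.Perm (Fin 3)) {M k : ℂ} {s : Multiset NegIndex}
    {γ : ℕ × ℕ} (h : monWt σ s ≠ ((γ.1 : ℤ), (γ.2 : ℤ))) {x : Verma M k}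
    (hx : x ∈ component M k γ) : (coordDual σ M k s).1 x = 0 := by
  by_contra hne
  exact h ((mem_supported ℂ _).1 (component_weight σ hx) (mem_support_iff.2 hne))

namespace MonomialIndex

theorem isDual_coordDual (σ : Equiv.Perm (Fin 3)) (M k : ℂ) {p : MonomialIndex}
    (hp : p.Admissible) (h : ∀ q : MonomialIndex, q.Admissible → q.degree = p.degree →
      q.vector M k = monVec σ M k (q.toNeg σ)) : p.IsDual (coordDual σ M k (p.toNeg σ)) := by
  refine ⟨fun γ hγ x hx => coordDual_component σ ?_ hx, ?_, fun q hq hqp hne => ?_⟩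
  · rw [monWt_toNeg σ hp]
    intro h
    simp only [Prod.mk.injEq, Nat.cast_inj] at h
    exact hγ (Prod.ext h.1.symm h.2.symm)
  · rw [h p hp rfl, coordDual_apply, toMonomials_monVec, single_eq_same]
  · rw [h q hq hqp, coordDual_apply, toMonomials_monVec, single_eq_of_ne]
    intro heq
    apply hne
    rw [← ofNeg_toNeg σ hp, heq, ofNeg_toNeg σ hq]

/-- A dual vector is determined by its values on words, that is, on the components: in the degree
of `p` it is prescribed on a spanning set, and it vanishes on the others. -/
theorem IsDual.unique {M k : ℂ} {p : MonomialIndex} {φ ψ : Contragredient M k}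
    (hφ : p.IsDual φ) (hψ : p.IsDual ψ) : φ = ψ := by
  set σ := order p.degree with hσ
  have hmon : ∀ s, monWt σ s = ((p.degree.1 : ℤ), (p.degree.2 : ℤ)) →
      φ.1 (monVec σ M k s) = ψ.1 (monVec σ M k s) := by
    intro s hs
    have hq := ofNeg_admissible σ s
    have hdeg : (ofNeg σ s).degree = p.degree := by
      rw [← toNeg_ofNeg σ s, monWt_toNeg σ hq] at hs
      simp only [Prod.mk.injEq, Nat.cast_inj] at hs
      exact Prod.ext hs.1 hs.2
    have hv : (ofNeg σ s).vector M k = monVec σ M k s := by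
      rw [vector_eq M k hq, hdeg, ← hσ, toNeg_ofNeg]
    rw [← hv]
    by_cases hqp : ofNeg σ s = p
    · rw [hqp, hφ.2.1, hψ.2.1]
    · rw [hφ.2.2 _ hq hdeg hqp, hψ.2.2 _ hq hdeg hqp]
  have hword : ∀ w, φ.1 (word M k w) = ψ.1 (word M k w) := by
    intro w
    by_cases hw : (w.count 0, w.count 1) = p.degree
    · have hx := component_weight σ (word_mem M k w)
      rw [hw] at hx
      have := eq_of_supported (f := φ.1 ∘ₗ (vermaBasis σ M k).repr.symm.toLinearMap)
        (g := ψ.1 ∘ₗ (vermaBasis σ M k).repr.symm.toLinearMap) (fun s hs => by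
          simpa [vermaBasis_apply] using hmon s hs) hx
      rw [← vermaBasis_repr] at this
      simpa using this
    · rw [hφ.1 _ hw _ (word_mem M k w), hψ.1 _ hw _ (word_mem M k w)]
  exact Subtype.ext (LinearMap.ext_on (span_range_word M k) (by
    rintro _ ⟨w, rfl⟩; exact hword w))

theorem existsUnique_isDual (M k : ℂ) {p : MonomialIndex} (hp : p.Admissible) :
    ∃! φ : Contragredient M k, p.IsDual φ :=
  ⟨_, isDual_coordDual (order p.degree) M k hp fun q hq hqp => by rw [vector_eq M k hq, hqp],
    fun _ hψ => hψ.unique <| isDual_coordDual (order p.degree) M k hp fun q hq hqp => by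
      rw [vector_eq M k hq, hqp]⟩

theorem dual_eq {M k : ℂ} {p : MonomialIndex} {φ : Contragredient M k} (h : p.IsDual φ) :
    dual M k p = φ :=
  (Classical.epsilon_spec (p := fun φ : Contragredient M k => p.IsDual φ) ⟨φ, h⟩).unique h

theorem dual_eq_coordDual (M k : ℂ) {p : MonomialIndex} (hp : p.Admissible) :
    dual M k p = coordDual (order p.degree) M k (p.toNeg (order p.degree)) :=
  dual_eq <| isDual_coordDual _ M k hp fun q hq hqp => by rw [vector_eq M k hq, hqp]

end MonomialIndex

/-- The vector `v*` is the coordinate functional of the empty monomial for every order. -/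
theorem vacDual_eq (σ : Equiv.Perm (Fin 3)) (M k : ℂ) : vacDual M k = coordDual σ M k 0 := by
  have hp : MonomialIndex.Admissible ⟨0, 0, 0⟩ := by simp [MonomialIndex.Admissible]
  have h0 : ∀ σ, MonomialIndex.toNeg σ ⟨0, 0, 0⟩ = 0 := fun σ => by
    have : ∀ r, MonomialIndex.part ⟨0, 0, 0⟩ r = 0 := fun r => by
      fin_cases r <;> rfl
    simp [MonomialIndex.toNeg, this]
  rw [vacDual, ← h0 σ]
  refine MonomialIndex.dual_eq <| MonomialIndex.isDual_coordDual σ M k hp fun q hq hdeg => ?_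
  -- the only monomial of degree zero is the empty one
  have hq0 : q = ⟨0, 0, 0⟩ := by
    obtain ⟨a, b, c⟩ := q
    simp only [MonomialIndex.degree, Prod.mk.injEq, Multiset.sum_zero, Multiset.card_zero] at hdeg
    have hb := Multiset.card_nsmul_le_sum hq.1
    have hc := Multiset.card_nsmul_le_sum hq.2
    simp only [smul_eq_mul, mul_one] at hb hc
    have ha0 : a.card = 0 := by omega
    have hb0 : b.card = 0 := by omega
    have hc0 : c.card = 0 := by omega
    rw [Multiset.card_eq_zero] at ha0 hb0 hc0
    rw [ha0, hb0, hc0]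
  rw [hq0, MonomialIndex.vector_eq M k hp, h0, h0]
  simp [monVec, monomial]

theorem fDual_eq (M k : ℂ) (b : ℕ) : fDual M k b = coordDual 1 M k {negIndex 0 b} := by
  have hp : MonomialIndex.Admissible ⟨{b}, 0, 0⟩ := by simp [MonomialIndex.Admissible]
  have ho : MonomialIndex.order (MonomialIndex.degree ⟨{b}, 0, 0⟩) = 1 :=
    if_pos (by simp [MonomialIndex.degree])
  rw [fDual, MonomialIndex.dual_eq_coordDual M k hp, ho]
  simp [MonomialIndex.toNeg, Fin.sum_univ_three, MonomialIndex.part, low]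

theorem ffDual_eq (M k : ℂ) (i j : ℕ) :
    ffDual M k i j = coordDual 1 M k {negIndex 0 i, negIndex 0 j} := by
  have hp : MonomialIndex.Admissible ⟨{i, j}, 0, 0⟩ := by simp [MonomialIndex.Admissible]
  have ho : MonomialIndex.order (MonomialIndex.degree ⟨{i, j}, 0, 0⟩) = 1 :=
    if_pos (by simp [MonomialIndex.degree])
  rw [ffDual, MonomialIndex.dual_eq_coordDual M k hp, ho]
  simp [MonomialIndex.toNeg, Fin.sum_univ_three, MonomialIndex.part, low]

theorem eDual_eq (M k : ℂ) (b : ℕ) :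
    eDual M k (b + 1) = coordDual Fin.revPerm M k {negIndex 0 b} := by
  have hp : MonomialIndex.Admissible ⟨0, 0, {b + 1}⟩ := by simp [MonomialIndex.Admissible]
  have ho : MonomialIndex.order (MonomialIndex.degree ⟨0, 0, {b + 1}⟩) = Fin.revPerm :=
    if_neg (by simp [MonomialIndex.degree])
  rw [eDual, MonomialIndex.dual_eq_coordDual M k hp, ho]
  simp [MonomialIndex.toNeg, Fin.sum_univ_three, MonomialIndex.part, low]

theorem eeDual_eq (M k : ℂ) (i j : ℕ) :
    eeDual M k (i + 1) (j + 1) = coordDual Fin.revPerm M k {negIndex 0 i, negIndex 0 j} := by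
  have hp : MonomialIndex.Admissible ⟨0, 0, {i + 1, j + 1}⟩ := by
    simp [MonomialIndex.Admissible]
  have ho : MonomialIndex.order (MonomialIndex.degree ⟨0, 0, {i + 1, j + 1}⟩) = Fin.revPerm :=
    if_neg (by simp [MonomialIndex.degree])
  rw [eeDual, MonomialIndex.dual_eq_coordDual M k hp, ho]
  simp [MonomialIndex.toNeg, Fin.sum_univ_three, MonomialIndex.part, low]

/-! ### The recursions -/

theorem root_rev_lie {r : Fin 3} (hr : r ≠ 1) :
    ⁅root r.rev, root r⁆ = (rootWt r : ℂ) • sl2H := by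
  fin_cases r
  · simp [root, rootWt, lie_E_F]
  · exact absurd rfl hr
  · have : ⁅sl2F, sl2E⁆ = -sl2H := by rw [← lie_skew, lie_E_F]
    simp [root, rootWt, this]

theorem trForm_root_rev {r : Fin 3} (hr : r ≠ 1) : trForm (root r.rev) (root r) = 1 := by
  fin_cases r
  · simp [root, trForm_apply, sl2E, sl2F, Matrix.trace_fin_two]
  · exact absurd rfl hr
  · simp [root, trForm_apply, sl2E, sl2F, Matrix.trace_fin_two]

theorem sl2H_lie_root (r : Fin 3) : ⁅sl2H, root r⁆ = (-2 * rootWt r : ℂ) • root r := by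
  fin_cases r
  · simpa [root, rootWt] using lie_H_F
  · simp [root, rootWt]
  · simpa [root, rootWt] using lie_H_E

theorem sl2Transpose_root (r : Fin 3) : sl2Transpose (root r) = root r.rev := by
  ext i j
  fin_cases r <;> fin_cases i <;> fin_cases j <;> simp [sl2Transpose, root, sl2E, sl2F, sl2H]

theorem lie_loop_rev {r : Fin 3} (hr : r ≠ 1) (m n : ℤ) :
    ⁅loop m (root r.rev), loop n (root r)⁆ =
      (rootWt r : ℂ) • loop (m + n) sl2H + (if m + n = 0 then (m : ℂ) else 0) • central := by
  rw [lie_loop, root_rev_lie hr, trForm_root_rev hr, mul_one, map_smul]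

theorem lie_loop_sl2H {r : Fin 3} (hr : r ≠ 1) (m n : ℤ) :
    ⁅loop m sl2H, loop n (root r)⁆ = (-2 * rootWt r : ℂ) • loop (m + n) (root r) := by
  have h : trForm sl2H (root r) = 0 :=
    (trForm_root 1 r).resolve_right (by revert r; decide)
  rw [lie_loop, sl2H_lie_root, h, mul_zero, ite_self, zero_smul, add_zero, map_smul]

theorem lie_loop_self {r : Fin 3} (hr : r ≠ 1) (m n : ℤ) :
    ⁅loop m (root r), loop n (root r)⁆ = 0 := by
  have h : trForm (root r) (root r) = 0 :=
    (trForm_root r r).resolve_right (by revert r; decide)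
  rw [lie_loop, lie_self, h, mul_zero, ite_self, zero_smul, add_zero, map_zero]

theorem lie_central_verma {M k : ℂ} (x : Verma M k) : ⁅central, x⁆ = k • x := by
  have h : ∀ u : U, toU central * u = u * toU central := by
    intro u
    induction u using toU_induction with
    | toU X =>
      rw [eq_comm, ← sub_eq_zero, ← toU_lie, lie_central, map_zero]
    | algebraMap r => exact (Algebra.commutes r _).symm
    | add u w hu hw => rw [mul_add, add_mul, hu, hw]
    | mul u w hu hw => rw [← mul_assoc, hu, mul_assoc, hw, mul_assoc]
  obtain ⟨u, rfl⟩ := exists_smul_vac x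
  rw [lie_eq_smul, ← mul_smul, h, mul_smul, ← lie_eq_smul, central_vac,
    ← algebraMap_smul U k (vac M k), ← algebraMap_smul U k (u • vac M k), ← mul_smul, ← mul_smul,
    Algebra.commutes]

section

variable {σ : Equiv.Perm (Fin 3)} {M k : ℂ}

/-- The elements at the first place commute, so they act on monomials by multiplication. -/
theorem monAct_first (hσ : σ 0 ≠ 1) (i : ℕ) (s : Multiset NegIndex) :
    monAct σ M k (overT (root (σ 0)) (i + low (σ 0))) (single s 1) =
      single (negIndex 0 i ::ₘ s) 1 := by
  rw [← splitBasis_neg]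
  refine act_inl_of_commute _ _ _ (fun j hj => ?_) s
  obtain ⟨r, n, rfl⟩ : ∃ r n, j = negIndex r n := ⟨(ofLex j).1, OrderDual.ofDual (ofLex j).2, rfl⟩
  obtain rfl : r = 0 := by
    rw [negIndex, Prod.Lex.toLex_le_toLex] at hj
    rcases hj with hj | hj
    · exact absurd hj (Fin.not_lt_zero _)
    · exact hj.1
  rw [negIndex, splitBasis_neg, splitBasis_neg]
  exact lie_loop_self hσ _ _

theorem monVec_cons_first (hσ : σ 0 ≠ 1) (i : ℕ) (s : Multiset NegIndex) :
    monVec σ M k (negIndex 0 i ::ₘ s) =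
      ⁅overT (root (σ 0)) (i + low (σ 0)), monVec σ M k s⁆ := by
  apply (vermaBasis σ M k).repr.injective
  rw [vermaBasis_repr, vermaBasis_repr, toMonomials_lie, toMonomials_monVec, toMonomials_monVec,
    monAct_first hσ]

theorem coordDual_cons_first (hσ : σ 0 ≠ 1) (i : ℕ) (s : Multiset NegIndex) (x : Verma M k) :
    (coordDual σ M k (negIndex 0 i ::ₘ s)).1 ⁅overT (root (σ 0)) (i + low (σ 0)), x⁆ =
      (coordDual σ M k s).1 x := by
  rw [coordDual_apply, coordDual_apply, toMonomials_lie]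
  refine eq_of_supported (P := Set.univ)
    (f := lapply (negIndex 0 i ::ₘ s) ∘ₗ monAct σ M k (overT (root (σ 0)) (i + low (σ 0))))
    (g := lapply s) (fun t _ => ?_) (by simp)
  classical
  rw [LinearMap.comp_apply, monAct_first hσ, lapply_apply, lapply_apply, single_apply,
    single_apply]
  simp only [Multiset.cons_inj_right]

theorem coordDual_first_of_notMem (hσ : σ 0 ≠ 1) {i : ℕ} {s : Multiset NegIndex}
    (hs : negIndex 0 i ∉ s) (x : Verma M k) :
    (coordDual σ M k s).1 ⁅overT (root (σ 0)) (i + low (σ 0)), x⁆ = 0 := by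
  rw [coordDual_apply, toMonomials_lie]
  refine eq_of_supported (P := Set.univ)
    (f := lapply s ∘ₗ monAct σ M k (overT (root (σ 0)) (i + low (σ 0))))
    (g := 0) (fun t _ => ?_) (by simp)
  rw [LinearMap.comp_apply, monAct_first hσ, lapply_apply, LinearMap.zero_apply,
    single_eq_of_ne]
  rintro rfl
  exact hs (Multiset.mem_cons_self _ _)

theorem negIndex_inj {i : Fin 3} {m n : ℕ} : negIndex i m = negIndex i n ↔ m = n := by
  simp [negIndex]

theorem coordDual_zero_first (hσ : σ 0 ≠ 1) (i : ℕ) (x : Verma M k) :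
    (coordDual σ M k 0).1 ⁅overT (root (σ 0)) (i + low (σ 0)), x⁆ = 0 :=
  coordDual_first_of_notMem hσ (Multiset.notMem_zero _) x

theorem coordDual_singleton_first (hσ : σ 0 ≠ 1) (i j : ℕ) (x : Verma M k) :
    (coordDual σ M k {negIndex 0 j}).1 ⁅overT (root (σ 0)) (i + low (σ 0)), x⁆ =
      if i = j then (coordDual σ M k 0).1 x else 0 := by
  split_ifs with h
  · subst h
    exact coordDual_cons_first hσ i 0 x
  · refine coordDual_first_of_notMem hσ ?_ x
    rwa [Multiset.mem_singleton, negIndex_inj]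

/-- Among the unordered pairs with sum `m` at most one contains `i`. -/
theorem sum_coordDual_pair_first (hσ : σ 0 ≠ 1) (i m : ℕ) (x : Verma M k) :
    ∑ ij ∈ (Finset.HasAntidiagonal.antidiagonal m).filter (fun ij => ij.2 ≤ ij.1),
        (coordDual σ M k {negIndex 0 ij.1, negIndex 0 ij.2}).1
          ⁅overT (root (σ 0)) (i + low (σ 0)), x⁆ =
      if i ≤ m then (coordDual σ M k {negIndex 0 (m - i)}).1 x else 0 := by
  have hne : ∀ p q : ℕ, i ≠ p → i ≠ q → (coordDual σ M k {negIndex 0 p, negIndex 0 q}).1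
      ⁅overT (root (σ 0)) (i + low (σ 0)), x⁆ = 0 := by
    intro p q hp hq
    refine coordDual_first_of_notMem hσ ?_ x
    simp only [Multiset.insert_eq_cons, Multiset.mem_cons, Multiset.mem_singleton, negIndex_inj]
    tauto
  split_ifs with him
  · rw [Finset.sum_eq_single (max i (m - i), min i (m - i))]
    · have : ({negIndex 0 (max i (m - i)), negIndex 0 (min i (m - i))} : Multiset NegIndex) =
          negIndex 0 i ::ₘ {negIndex 0 (m - i)} := by
        rcases le_total i (m - i) with h | h
        · rw [max_eq_right h, min_eq_left h]; exact Multiset.cons_swap _ _ _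
        · rw [max_eq_left h, min_eq_right h]; rfl
      rw [this, coordDual_cons_first hσ]
    · rintro ⟨p, q⟩ hpq hne'
      rw [Finset.mem_filter, Finset.HasAntidiagonal.mem_antidiagonal] at hpq
      dsimp only at hpq
      refine hne p q ?_ ?_ <;> rintro rfl <;> apply hne' <;> ext <;> dsimp only <;> omega
    · intro h
      exfalso
      apply h
      rw [Finset.mem_filter, Finset.HasAntidiagonal.mem_antidiagonal]
      dsimp only
      omega
  · refine Finset.sum_eq_zero ?_
    rintro ⟨p, q⟩ hpq
    rw [Finset.mem_filter, Finset.HasAntidiagonal.mem_antidiagonal] at hpq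
    dsimp only at hpq
    exact hne p q (by omega) (by omega)

/-- The functional `v*` is an eigenvector of `h`, because all ordered monomials are. -/
theorem coordDual_zero_sl2H (x : Verma M k) :
    (coordDual σ M k 0).1 ⁅loop 0 sl2H, x⁆ = M * (coordDual σ M k 0).1 x := by
  have hvac : ⁅loop 0 sl2H, monVec σ M k 0⁆ = M • monVec σ M k 0 := by
    rw [monVec, monomial, Multiset.sort_zero]
    exact chevH_vac M k 0
  have hdiag : ∀ s, ∃ c : ℂ, ⁅loop 0 sl2H, monVec σ M k s⁆ = c • monVec σ M k s := by
    intro s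
    induction s using min_induction with
    | zero => exact ⟨M, hvac⟩
    | cons j t hj ih =>
      obtain ⟨c, hc⟩ := ih t le_rfl
      obtain ⟨d, hd⟩ : ∃ d : ℂ, ⁅loop 0 sl2H, splitBasis σ (.inl j)⁆ =
          d • splitBasis σ (.inl j) := by
        obtain ⟨r, n, rfl⟩ : ∃ r n, j = negIndex r n :=
          ⟨(ofLex j).1, OrderDual.ofDual (ofLex j).2, rfl⟩
        refine ⟨-2 * rootWt (σ r), ?_⟩
        rw [negIndex, splitBasis_neg, overT, lie_loop, Int.cast_zero, zero_mul, ite_self,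
          zero_smul, add_zero, sl2H_lie_root, map_smul, zero_add]
      refine ⟨d + c, ?_⟩
      rw [monVec, monomial_cons _ _ hj, ← monVec, leibniz_lie, hd, hc, smul_lie, lie_smul,
        add_smul]
  refine LinearMap.congr_fun (f := (coordDual σ M k 0).1 ∘ₗ op M k (loop 0 sl2H))
    (g := M • (coordDual σ M k 0).1) ((vermaBasis σ M k).ext fun s => ?_) x
  rw [vermaBasis_apply, LinearMap.comp_apply, op_apply, LinearMap.smul_apply]
  by_cases hs : s = 0
  · subst hs
    rw [hvac, map_smul]
  · obtain ⟨c, hc⟩ := hdiag s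
    rw [hc, map_smul, coordDual_apply, toMonomials_monVec, single_eq_of_ne (Ne.symm hs), smul_zero,
      smul_zero]

theorem coordDual_eq_zero_of_weight {s t : Multiset NegIndex} {n : ℤ} {r : Fin 3}
    (h : monWt σ t ≠ (rootWt r - n, -n) + monWt σ s) :
    (coordDual σ M k t).1 ⁅loop n (root r), monVec σ M k s⁆ = 0 := by
  rw [coordDual_apply, toMonomials_lie, toMonomials_monVec]
  by_contra hne
  exact h ((mem_supported ℂ _).1
    (monAct_mem_weight σ M k n r (single_mem_supported ℂ _ rfl)) (mem_support_iff.2 hne))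

theorem monWt_snd_nonneg (s : Multiset NegIndex) : 0 ≤ (monWt σ s).2 := by
  induction s using Multiset.induction with
  | empty => exact le_rfl
  | cons x s ih =>
    have := monWt_cons σ (ofLex x).1 (OrderDual.ofDual (ofLex x).2) s
    rw [show x = negIndex (ofLex x).1 (OrderDual.ofDual (ofLex x).2) from rfl, this, Prod.snd_add]
    positivity

theorem rootWt_mul_nonpos : ∀ r t : Fin 3, r ≠ 1 → t ≠ r → rootWt r * rootWt t ≤ 0 := by
  decide

theorem rootWt_mul_self : ∀ r : Fin 3, r ≠ 1 → rootWt r * rootWt r = 1 := by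
  decide

theorem monWt_singleton (i : ℕ) : monWt σ {negIndex 0 i} =
    (rootWt (σ 0) + (i + low (σ 0) : ℕ), ((i + low (σ 0) : ℕ) : ℤ)) := by
  have := monWt_cons σ 0 i 0
  rwa [show monWt σ 0 = 0 from rfl, add_zero] at this

/-- A monomial with the degree of a single element of the first block has a factor from this
block, with an exponent which is not larger. -/
theorem exists_first_mem (hσ : σ 0 ≠ 1) {b : ℕ} {s : Multiset NegIndex}
    (hs : monWt σ s = monWt σ {negIndex 0 b}) : ∃ i ≤ b, negIndex 0 i ∈ s := by
  have hb := monWt_singleton (σ := σ) b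
  have hex : ∃ i, negIndex 0 i ∈ s := by
    by_contra! hno
    -- up to the sign `rootWt (σ 0)`, no other factor raises the difference of the degrees
    have key : ∀ t : Multiset NegIndex, (∀ i, negIndex 0 i ∉ t) →
        rootWt (σ 0) * ((monWt σ t).1 - (monWt σ t).2) ≤ 0 := by
      intro t
      induction t using Multiset.induction with
      | empty => intro _; exact le_of_eq (mul_zero _)
      | cons x t ih =>
        intro hx
        obtain ⟨r, n, rfl⟩ : ∃ r n, x = negIndex r n :=
          ⟨(ofLex x).1, OrderDual.ofDual (ofLex x).2, rfl⟩
        have hr : σ r ≠ σ 0 := by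
          intro h
          rw [σ.injective h] at hx
          exact hx n (Multiset.mem_cons_self _ _)
        have h1 := ih fun i hi => hx i (Multiset.mem_cons_of_mem hi)
        have h2 := rootWt_mul_nonpos (σ 0) (σ r) hσ hr
        rw [monWt_cons, Prod.fst_add, Prod.snd_add]
        linear_combination h1 + h2
    have h1 := key s hno
    rw [hs, hb, add_sub_cancel_right, rootWt_mul_self _ hσ] at h1
    omega
  obtain ⟨i, hi⟩ := hex
  refine ⟨i, ?_, hi⟩
  obtain ⟨t, rfl⟩ := Multiset.exists_cons_of_mem hi
  have h1 := congrArg Prod.snd hs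
  rw [hb, monWt_cons, Prod.snd_add] at h1
  have h2 := monWt_snd_nonneg (σ := σ) t
  dsimp only at h1
  push_cast at h1
  omega

theorem monWt_pair (i j : ℕ) : monWt σ {negIndex 0 i, negIndex 0 j} =
    monWt σ {negIndex 0 i} + monWt σ {negIndex 0 j} := by
  rw [← monWt_add]; rfl

end

/-- The value of the recursion at a vector starting with a factor from the first place. No assumption
on `y` is needed. -/
theorem recursion_first (σ : Equiv.Perm (Fin 3)) (hσ : σ 0 ≠ 1) {M k : ℂ} {b i : ℕ} (hi : i ≤ b)
    (y : Verma M k) :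
    (rootWt (σ 0) * M + low (σ 0) * k + b * (k + 2)) *
        (coordDual σ M k {negIndex 0 b}).1 ⁅overT (root (σ 0)) (i + low (σ 0)), y⁆ =
      (coordDual σ M k 0).1 ⁅loop ((b + low (σ 0) : ℕ) : ℤ) (root (σ 0).rev),
          ⁅overT (root (σ 0)) (i + low (σ 0)), y⁆⁆ -
        ∑ l ∈ Finset.Icc 1 b,
          (2 * ∑ ij ∈ (Finset.HasAntidiagonal.antidiagonal (b - l)).filter
              (fun ij => ij.2 ≤ ij.1), (coordDual σ M k {negIndex 0 ij.1, negIndex 0 ij.2}).1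
                ⁅loop ((l : ℤ) - low (σ 0)) (root (σ 0)),
                  ⁅overT (root (σ 0)) (i + low (σ 0)), y⁆⁆ +
            rootWt (σ 0) * (coordDual σ M k {negIndex 0 (b - l)}).1
              ⁅loop (l : ℤ) sl2H, ⁅overT (root (σ 0)) (i + low (σ 0)), y⁆⁆) := by
  set r := σ 0 with hr
  have hε : (rootWt r : ℂ) * rootWt r = 1 := by exact_mod_cast rootWt_mul_self r hσ
  -- move the factor `i` to the left in each of the three kinds of terms
  have h1 : (coordDual σ M k 0).1 ⁅loop ((b + low r : ℕ) : ℤ) (root r.rev),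
      ⁅overT (root r) (i + low r), y⁆⁆ =
      rootWt r * (coordDual σ M k 0).1 ⁅loop ((b : ℤ) - i) sl2H, y⁆ +
        if i = b then ((b : ℂ) + low r) * (k * (coordDual σ M k 0).1 y) else 0 := by
    have e : ((b + low r : ℕ) : ℤ) + -((i + low r : ℕ) : ℤ) = b - i := by push_cast; ring
    rw [leibniz_lie, map_add, coordDual_zero_first hσ, add_zero, overT, lie_loop_rev hσ, e,
      add_lie, smul_lie, smul_lie, lie_central_verma, map_add, map_smul, map_smul, map_smul]
    congr 1
    by_cases hib : i = b
    · rw [if_pos hib, if_pos (by omega)]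
      simp
    · rw [if_neg hib, if_neg (by omega), zero_smul]
  have h2 : ∀ l : ℕ, ∑ ij ∈ (Finset.HasAntidiagonal.antidiagonal (b - l)).filter
        (fun ij => ij.2 ≤ ij.1), (coordDual σ M k {negIndex 0 ij.1, negIndex 0 ij.2}).1
          ⁅loop ((l : ℤ) - low r) (root r), ⁅overT (root r) (i + low r), y⁆⁆ =
      if i ≤ b - l then (coordDual σ M k {negIndex 0 (b - l - i)}).1
        ⁅loop ((l : ℤ) - low r) (root r), y⁆ else 0 := by
    intro l
    have e : ⁅loop ((l : ℤ) - low r) (root r), ⁅overT (root r) (i + low r), y⁆⁆ =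
        ⁅overT (root r) (i + low r), ⁅loop ((l : ℤ) - low r) (root r), y⁆⁆ := by
      rw [leibniz_lie, overT, lie_loop_self hσ, zero_lie, zero_add]
    rw [e]
    exact sum_coordDual_pair_first hσ i (b - l) _
  have h3 : ∀ l : ℕ, l ≤ b → (coordDual σ M k {negIndex 0 (b - l)}).1
        ⁅loop (l : ℤ) sl2H, ⁅overT (root r) (i + low r), y⁆⁆ =
      -2 * rootWt r * (if l ≤ i then if i = b then (coordDual σ M k 0).1 y else 0
        else (coordDual σ M k {negIndex 0 (b - l)}).1
          ⁅loop (((l - i : ℕ) : ℤ) - low r) (root r), y⁆) +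
      if i = b - l then (coordDual σ M k 0).1 ⁅loop (l : ℤ) sl2H, y⁆ else 0 := by
    intro l hl
    rw [leibniz_lie, map_add, coordDual_singleton_first hσ, overT, lie_loop_sl2H hσ, smul_lie,
      map_smul, smul_eq_mul]
    congr 2
    by_cases hli : l ≤ i
    · have e : loop ((l : ℤ) + -((i + low r : ℕ) : ℤ)) (root r) =
          overT (root r) ((i - l) + low r) := by
        rw [overT]
        congr 2
        push_cast [Nat.cast_sub hli]
        ring
      rw [if_pos hli, e, coordDual_singleton_first hσ]
      exact if_congr (by omega) rfl rfl
    · rw [if_neg hli]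
      congr 4
      push_cast [Nat.cast_sub (le_of_not_ge hli)]
      ring
  have h4 : ∀ l ∈ Finset.Icc 1 b, l ≤ b := fun l hl => (Finset.mem_Icc.1 hl).2
  rw [h1, coordDual_singleton_first hσ, Finset.sum_congr rfl fun l hl => by
    rw [h2 l, h3 l (h4 l hl)]]
  rcases eq_or_lt_of_le hi with rfl | hib
  · -- for `i = b` only the term of `v*` and the commutators of `h T^l` contribute
    have e : ∀ l ∈ Finset.Icc 1 i, 2 * (if i ≤ i - l then
          (coordDual σ M k {negIndex 0 (i - l - i)}).1 ⁅loop ((l : ℤ) - low r) (root r), y⁆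
            else 0) +
        rootWt r * (-2 * rootWt r * (if l ≤ i then if i = i then (coordDual σ M k 0).1 y else 0
          else (coordDual σ M k {negIndex 0 (i - l)}).1
            ⁅loop (((l - i : ℕ) : ℤ) - low r) (root r), y⁆) +
          if i = i - l then (coordDual σ M k 0).1 ⁅loop (l : ℤ) sl2H, y⁆ else 0) =
        -2 * (coordDual σ M k 0).1 y := by
      intro l hl
      rw [Finset.mem_Icc] at hl
      rw [if_neg (by omega), if_pos hl.2, if_pos rfl, if_neg (by omega)]
      linear_combination -2 * (coordDual σ M k 0).1 y * hε
    rw [Finset.sum_congr rfl e, Finset.sum_const, Nat.card_Icc, if_pos rfl, if_pos rfl, sub_self,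
      coordDual_zero_sl2H, nsmul_eq_mul, Nat.add_sub_cancel]
    ring
  · -- for `i < b` the contributions of the pairs cancel those of the commutators of `h T^l`, and the
    -- remaining term with `l = b - i` cancels the term of `v*`
    have eA : ∑ l ∈ Finset.Icc 1 b, (if i ≤ b - l then
          (coordDual σ M k {negIndex 0 (b - l - i)}).1 ⁅loop ((l : ℤ) - low r) (root r), y⁆
            else 0) =
        ∑ l ∈ Finset.Icc 1 (b - i), (coordDual σ M k {negIndex 0 (b - i - l)}).1
          ⁅loop ((l : ℤ) - low r) (root r), y⁆ := by
      rw [← Finset.sum_filter]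
      refine Finset.sum_congr ?_ fun l _ => by rw [Nat.sub_right_comm]
      ext l
      simp only [Finset.mem_filter, Finset.mem_Icc]
      omega
    have eB : ∑ l ∈ Finset.Icc 1 b, (if l ≤ i then 0
          else (coordDual σ M k {negIndex 0 (b - l)}).1
            ⁅loop (((l - i : ℕ) : ℤ) - low r) (root r), y⁆) =
        ∑ l ∈ Finset.Icc 1 (b - i), (coordDual σ M k {negIndex 0 (b - i - l)}).1
          ⁅loop ((l : ℤ) - low r) (root r), y⁆ := by
      rw [Finset.sum_ite, Finset.sum_const_zero, zero_add]
      refine Finset.sum_nbij' (· - i) (· + i) ?_ ?_ ?_ ?_ ?_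
      · intro l hl
        simp only [Finset.mem_filter, Finset.mem_Icc] at hl ⊢
        omega
      · intro l hl
        simp only [Finset.mem_filter, Finset.mem_Icc] at hl ⊢
        omega
      · intro l hl
        simp only [Finset.mem_filter, Finset.mem_Icc] at hl
        omega
      · intro l _
        exact Nat.add_sub_cancel _ _
      · intro l hl
        simp only [Finset.mem_filter, Finset.mem_Icc] at hl
        rw [show b - i - (l - i) = b - l by omega]
    have eC : ∑ l ∈ Finset.Icc 1 b,
          (if i = b - l then (coordDual σ M k 0).1 ⁅loop (l : ℤ) sl2H, y⁆ else 0) =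
        (coordDual σ M k 0).1 ⁅loop ((b : ℤ) - i) sl2H, y⁆ := by
      rw [Finset.sum_eq_single (b - i), if_pos (by omega), Nat.cast_sub hi]
      · intro l hl hne
        rw [Finset.mem_Icc] at hl
        exact if_neg (by omega)
      · intro h
        exact absurd (Finset.mem_Icc.2 (by omega)) h
    simp only [if_neg hib.ne, mul_add, Finset.sum_add_distrib, ← Finset.mul_sum]
    rw [eA, eB, eC]
    linear_combination (-2) * (∑ l ∈ Finset.Icc 1 (b - i),
      (coordDual σ M k {negIndex 0 (b - i - l)}).1 ⁅loop ((l : ℤ) - low r) (root r), y⁆) * hε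

/-- The common form of the two recursions. The order `f`, `h`, `e` of the factors gives the one for
`f/T^b`, and the order `e`, `h`, `f` gives the one for `e/T^(b + 1)`. -/
theorem coordDual_recursion (σ : Equiv.Perm (Fin 3)) (hσ : σ 0 ≠ 1) (M k : ℂ) (b : ℕ) :
    (rootWt (σ 0) * M + low (σ 0) * k + b * (k + 2)) • coordDual σ M k {negIndex 0 b} =
      ⁅overT (root (σ 0)) (b + low (σ 0)), coordDual σ M k 0⁆ -
        ∑ l ∈ Finset.Icc 1 b,
          ((2 : ℂ) • ⁅loop (low (σ 0) - (l : ℤ)) (root (σ 0).rev),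
              ∑ ij ∈ (Finset.HasAntidiagonal.antidiagonal (b - l)).filter (fun ij => ij.2 ≤ ij.1),
                coordDual σ M k {negIndex 0 ij.1, negIndex 0 ij.2}⁆ +
            (rootWt (σ 0) : ℂ) • ⁅overT sl2H l, coordDual σ M k {negIndex 0 (b - l)}⁆) := by
  refine Subtype.ext ((vermaBasis σ M k).ext fun s => ?_)
  have hH : sl2Transpose sl2H = sl2H := sl2Transpose_root 1
  rw [vermaBasis_apply]
  simp only [Submodule.coe_sub, Submodule.coe_sum, Submodule.coe_add, Submodule.coe_smul,
    LinearMap.sub_apply, LinearMap.sum_apply, LinearMap.add_apply, LinearMap.smul_apply,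
    lie_contragredient_apply, overT, tau_loop, sl2Transpose_root, Fin.rev_rev, neg_neg, neg_sub,
    hH, smul_eq_mul]
  by_cases hs : monWt σ s = monWt σ {negIndex 0 b}
  · obtain ⟨i, hi, his⟩ := exists_first_mem hσ hs
    obtain ⟨t, rfl⟩ := Multiset.exists_cons_of_mem his
    rw [monVec_cons_first hσ]
    exact recursion_first σ hσ hi _
  · -- both sides are homogeneous of the degree of the monomial `b`
    have hr : rootWt (σ 0).rev = -rootWt (σ 0) := by
      generalize σ 0 = r; revert r; decide
    rw [monWt_singleton] at hs
    rw [coordDual_apply, toMonomials_monVec, single_eq_of_ne, coordDual_eq_zero_of_weight,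
      Finset.sum_eq_zero, mul_zero, sub_zero]
    · intro l hl
      rw [Finset.mem_Icc] at hl
      rw [Finset.sum_eq_zero, ← show root 1 = sl2H from rfl, coordDual_eq_zero_of_weight,
        mul_zero, mul_zero, add_zero]
      · rw [monWt_singleton]
        intro h
        apply hs
        simp only [Prod.ext_iff, Prod.fst_add, Prod.snd_add] at h ⊢
        push_cast [Nat.cast_sub hl.2, show rootWt 1 = 0 from rfl] at h ⊢
        omega
      · rintro ⟨p, q⟩ hpq
        rw [Finset.mem_filter, Finset.HasAntidiagonal.mem_antidiagonal] at hpq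
        refine coordDual_eq_zero_of_weight ?_
        rw [monWt_pair, monWt_singleton, monWt_singleton]
        intro h
        apply hs
        simp only [Prod.ext_iff, Prod.fst_add, Prod.snd_add] at h hpq ⊢
        push_cast at h ⊢
        omega
    · intro h
      apply hs
      rw [show monWt σ 0 = 0 from rfl] at h
      simp only [Prod.ext_iff, Prod.fst_add, Prod.snd_add, Prod.fst_zero, Prod.snd_zero, hr]
        at h ⊢
      push_cast at h ⊢
      omega
    · rintro rfl
      exact hs (monWt_singleton b)

end AffineSl2

end

theorem theorem5 (M k : ℂ) :
    -- the dual basis vectors exist and are unique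
    (∀ p : AffineSl2.MonomialIndex, p.Admissible →
      ∃! φ : AffineSl2.Contragredient M k, p.IsDual φ) ∧
    -- (a)
    (∀ b : ℕ, 1 ≤ b →
      (M + b * (k + 2)) • AffineSl2.fDual M k b =
        ⁅AffineSl2.overT AffineSl2.sl2F b, AffineSl2.vacDual M k⁆ -
          ∑ l ∈ Finset.Icc 1 b,
            ((2 : ℂ) • ⁅AffineSl2.overT AffineSl2.sl2E l,
                ∑ ij ∈ (Finset.HasAntidiagonal.antidiagonal (b - l)).filter (fun ij => ij.2 ≤ ij.1),
                  AffineSl2.ffDual M k ij.1 ij.2⁆ +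
              ⁅AffineSl2.overT AffineSl2.sl2H l, AffineSl2.fDual M k (b - l)⁆)) ∧
    -- (b)
    (∀ b : ℕ, 2 ≤ b →
      (k - M + (b - 1) * (k + 2)) • AffineSl2.eDual M k b =
        ⁅AffineSl2.overT AffineSl2.sl2E b, AffineSl2.vacDual M k⁆ +
          ∑ l ∈ Finset.Icc 0 (b - 2),
            ((-2 : ℂ) • ⁅AffineSl2.overT AffineSl2.sl2F l,
                ∑ ij ∈ (Finset.HasAntidiagonal.antidiagonal (b - l)).filter
                  (fun ij => ij.2 ≤ ij.1 ∧ 1 ≤ ij.2),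
                  AffineSl2.eeDual M k ij.1 ij.2⁆ +
              ⁅AffineSl2.overT AffineSl2.sl2H (l + 1),
                AffineSl2.eDual M k (b - l - 1)⁆)) := by
  open AffineSl2 in
  refine ⟨fun p hp => MonomialIndex.existsUnique_isDual M k hp, fun b _ => ?_, fun b hb => ?_⟩
  · have h := coordDual_recursion 1 (by decide) M k b
    simp only [← fDual_eq, ← ffDual_eq, ← vacDual_eq] at h
    simpa [root, rootWt, low, overT] using h
  · obtain ⟨b, rfl⟩ : ∃ n, b = n + 1 := ⟨b - 1, by omega⟩
    have h := coordDual_recursion Fin.revPerm (by decide) M k b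
    simp only [← eDual_eq, ← eeDual_eq, ← vacDual_eq] at h
    -- the second recursion starts with `e/T` instead of `f`, so all indices are shifted by one
    have e2 : Finset.Icc 1 b = (Finset.Icc 0 (b + 1 - 2)).map (addRightEmbedding 1) := by
      ext l
      simp only [Finset.mem_map, Finset.mem_Icc, addRightEmbedding_apply]
      constructor
      · intro hl; exact ⟨l - 1, by omega, by omega⟩
      · rintro ⟨m, hm, rfl⟩; omega
    have e3 : ∀ l ∈ Finset.Icc 0 (b + 1 - 2),
        ∑ ij ∈ (Finset.HasAntidiagonal.antidiagonal (b + 1 - l)).filter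
            (fun ij => ij.2 ≤ ij.1 ∧ 1 ≤ ij.2), eeDual M k ij.1 ij.2 =
          ∑ ij ∈ (Finset.HasAntidiagonal.antidiagonal (b - (l + 1))).filter
            (fun ij => ij.2 ≤ ij.1), eeDual M k (ij.1 + 1) (ij.2 + 1) := by
      intro l hl
      rw [Finset.mem_Icc] at hl
      refine Finset.sum_nbij' (fun ij => (ij.1 - 1, ij.2 - 1)) (fun ij => (ij.1 + 1, ij.2 + 1))
        ?_ ?_ ?_ ?_ ?_
      · rintro ⟨p, q⟩ hpq
        rw [Finset.mem_filter, Finset.HasAntidiagonal.mem_antidiagonal] at hpq ⊢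
        dsimp only at hpq ⊢
        omega
      · rintro ⟨p, q⟩ hpq
        rw [Finset.mem_filter, Finset.HasAntidiagonal.mem_antidiagonal] at hpq ⊢
        dsimp only at hpq ⊢
        omega
      · rintro ⟨p, q⟩ hpq
        rw [Finset.mem_filter, Finset.HasAntidiagonal.mem_antidiagonal] at hpq
        dsimp only at hpq ⊢
        ext <;> dsimp only <;> omega
      · rintro ⟨p, q⟩ _
        rfl
      · rintro ⟨p, q⟩ hpq
        rw [Finset.mem_filter, Finset.HasAntidiagonal.mem_antidiagonal] at hpq
        dsimp only at hpq ⊢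
        rw [Nat.sub_add_cancel (by omega), Nat.sub_add_cancel hpq.2.2]
    have hσ : (Fin.revPerm 0 : Fin 3) = 2 := by decide
    rw [hσ, e2, Finset.sum_map] at h
    refine (Eq.trans ?_ h).trans ?_
    · congr 1
      simp only [rootWt, low, Matrix.cons_val]
      push_cast
      ring
    · rw [sub_eq_add_neg, ← Finset.sum_neg_distrib]
      refine congrArg₂ (· + ·) rfl (Finset.sum_congr rfl fun l hl => ?_)
      have e4 : loop ((low 2 : ℤ) - ((l + 1 : ℕ) : ℤ)) (root (Fin.rev 2)) = overT sl2F l := by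
        change loop _ sl2F = loop _ sl2F
        congr 2
        simp [low]
      have e5 : b - (l + 1) + 1 = b + 1 - l - 1 := by
        rw [Finset.mem_Icc] at hl
        omega
      rw [e3 l hl, addRightEmbedding_apply, e4, e5]
      simp only [rootWt, Matrix.cons_val, Int.cast_neg, Int.cast_one]
      module
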